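/- **Model.** A randomized $p$-pass streaming algorithm with $S$ bits of space has a memory in $\{0,1\}^S$. It reads the edges of the input graph, each exactly once per pass together with its weight, in an arbitrary order that is the same in all $p$ passes. After each item the memory is replaced by an arbitrary function of the old memory, the item read, the number of the pass, the position in the stream, and a random string drawn once from an arbitrary probability space (the random string is not charged to the space). After the last pass the algorithm outputs a function of the memory and the random string. The number $n$ of vertices, the vertex set, and the vertices $s \ne t$ are known to it in advance. It computes a quantity with probability at least $\delta$ if, for every admissible input graph and every order of its edges, the output equals that quantity with probability at least $\delta$. The value of a minimum $s$-$t$ cut is the minimum, over all vertex sets $A$ with $s\in A$, $t\notin A$, of the total weight of the edges from $A$ to its complement (undirected: with exactly one endpoint in $A$). The maximum $s$-$t$ flow value is taken with the weights as capacities (undirected: an edge may be used in both directions and carries at most its capacity in total). **Theorem 6.1.** There is an absolute constant $C$ such that for every constant $\delta>0$ there are $c>0$ and $n_0$ such that the following holds for all integers $n\ge n_0$ and $p\ge 1$ and all pairs $s \neq t$ among the $n$ vertices. Every randomized $p$-pass streaming algorithm that computes, with probability at least $\delta$, the minimum $s$-$t$ cut value of every weighted directed graph on the $n$ vertices uses at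 least $c\, n^2/p^5$ bits of space. The same holds for weighted undirected graphs, and the same two bounds hold for the maximum $s$-$t$ flow value. All this holds even if correctness is required only on graphs without loops and parallel edges whose edge weights are integers between $1$ and $n^{Cp}$. -/

import Mathlib

open MeasureTheory

/-- A deterministic streaming algorithm that makes `p` passes over a stream of items of type `α`
with `S` bits of memory.  The memory is the only thing that is carried from one item of the stream
to the next one and from one pass to the next one.  The update rule is arbitrary (no restriction on
computing power) and may also depend on the number of the pass and on the position in the stream;
the output is an arbitrary function of the final content of the memory. -/
structure StreamAlg (α : Type) (p S : ℕ) where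
  /-- initial content of the memory -/
  init : Fin S → Bool
  /-- new content of the memory, given the pass, the position, the item read, the old content -/
  step : Fin p → ℕ → α → (Fin S → Bool) → (Fin S → Bool)
  /-- the answer that is given after the last pass -/
  out : (Fin S → Bool) → ℝ

namespace StreamAlg

variable {α : Type} {p S : ℕ}

/-- One pass: the items of the stream `σ` are read one by one, from the first to the last. -/
def runPass (A : StreamAlg α p S) (i : Fin p) (σ : List α) (m : Fin S → Bool) : Fin S → Bool :=
  σ.zipIdx.foldl (fun m x => A.step i x.2 x.1 m) m

/-- The content of the memory after all `p` passes over `σ`. -/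
def finalMemory (A : StreamAlg α p S) (σ : List α) : Fin S → Bool :=
  (List.finRange p).foldl (fun m i => A.runPass i σ m) A.init

/-- The output of the algorithm on the stream `σ`. -/
def run (A : StreamAlg α p S) (σ : List α) : ℝ :=
  A.out (A.finalMemory σ)

end StreamAlg

/-! ### Weighted graphs

A weighted directed graph on `V` without parallel edges is given by `w : V × V → ℕ`, a weighted
undirected one by `w : Sym2 V → ℕ`.  The edges are the pairs of positive weight. -/

/-- A stream of the graph: each edge occurs exactly once, together with its weight; the order is
arbitrary. -/
def IsEdgeStream {ε : Type} (w : ε → ℕ) (σ : List (ε × ℕ)) : Prop :=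
  σ.Nodup ∧ ∀ (e : ε) (x : ℕ), (e, x) ∈ σ ↔ w e = x ∧ 0 < x

/-- A directed graph without loops and with all weights at most `W`. -/
def AdmissibleDirected {V : Type} (W : ℕ) (w : V × V → ℕ) : Prop :=
  (∀ v, w (v, v) = 0) ∧ ∀ e, w e ≤ W

/-- An undirected graph without loops and with all weights at most `W`. -/
def AdmissibleUndirected {V : Type} (W : ℕ) (w : Sym2 V → ℕ) : Prop :=
  (∀ v, w s(v, v) = 0) ∧ ∀ e, w e ≤ W

section CutsAndFlows

variable {V : Type} [Fintype V] [DecidableEq V]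

/-- `x` is the minimum weight of an `s`-`t` cut of a directed graph: the minimum, over all vertex
sets `A` that contain `s` but not `t`, of the total weight of the edges that leave `A`. -/
def IsMinCutDirected (s t : V) (w : V × V → ℕ) (x : ℝ) : Prop :=
  IsLeast {y : ℝ | ∃ A : Finset V, s ∈ A ∧ t ∉ A ∧ y = ∑ u ∈ A, ∑ v ∈ Aᶜ, (w (u, v) : ℝ)} x

/-- `x` is the minimum weight of an `s`-`t` cut of an undirected graph: the minimum, over all vertex
sets `A` that contain `s` but not `t`, of the total weight of the edges with exactly one endpoint
in `A`. -/
def IsMinCutUndirected (s t : V) (w : Sym2 V → ℕ) (x : ℝ) : Prop :=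
  IsLeast {y : ℝ | ∃ A : Finset V, s ∈ A ∧ t ∉ A ∧ y = ∑ u ∈ A, ∑ v ∈ Aᶜ, (w s(u, v) : ℝ)} x

/-- `f u v` is the amount sent from `u` to `v`; it is nonnegative, and at every vertex other than
`s` and `t` the incoming amount equals the outgoing amount. -/
def IsConserved (s t : V) (f : V → V → ℝ) : Prop :=
  (∀ u v, 0 ≤ f u v) ∧ ∀ v, v ≠ s → v ≠ t → ∑ u, f u v = ∑ u, f v u

/-- The value of a flow: the net amount that leaves the source. -/
def flowValue (s : V) (f : V → V → ℝ) : ℝ :=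
  ∑ v, f s v - ∑ v, f v s

/-- `x` is the maximum value of an `s`-`t` flow in a directed graph with capacities `w`. -/
def IsMaxFlowDirected (s t : V) (w : V × V → ℕ) (x : ℝ) : Prop :=
  IsGreatest {y : ℝ | ∃ f : V → V → ℝ,
    IsConserved s t f ∧ (∀ u v, f u v ≤ w (u, v)) ∧ y = flowValue s f} x

/-- `x` is the maximum value of an `s`-`t` flow in an undirected graph with capacities `w`: an edge
may be used in both directions, and the total amount that it carries is at most its capacity. -/
def IsMaxFlowUndirected (s t : V) (w : Sym2 V → ℕ) (x : ℝ) : Prop :=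
  IsGreatest {y : ℝ | ∃ f : V → V → ℝ,
    IsConserved s t f ∧ (∀ u v, f u v + f v u ≤ w s(u, v)) ∧ y = flowValue s f} x

end CutsAndFlows

/-- The randomized streaming algorithm that draws `ω` from the probability space `(Ω, P)` and then
runs `A ω` answers correctly with probability at least `δ`, on every stream of every admissible
weighted graph.  (`ω` is available throughout and is not charged to the memory.  The output is a
random variable on these inputs.) -/
def Computes {ε Ω : Type} [MeasurableSpace Ω] {p S : ℕ}
    (P : Measure Ω) (A : Ω → StreamAlg (ε × ℕ) p S) (δ : ℝ)
    (Admissible : (ε → ℕ) → Prop) (IsAnswer : (ε → ℕ) → ℝ → Prop) : Prop :=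
  ∀ w : ε → ℕ, Admissible w → ∀ σ : List (ε × ℕ), IsEdgeStream w σ →
    Measurable (fun ω => (A ω).run σ) ∧
      ENNReal.ofReal δ ≤ P {ω | IsAnswer w ((A ω).run σ)}

/-!
An algorithm that uses `p` passes and `S` bits is made to chase a path that is hidden in a layered
network. The network has `k = p + 1` layers between levels of `m` vertices, where `m` is of order
`n / p`. Layer `i` consists of two matrices of bits, held by two players: two random disjoint
subsets of the set of `m ^ 2` places (`basePair`), except that one place is put into both sets
(`plant`). These places form a path that starts at a fixed vertex `x₀`. In each pass the layers are
read in the order opposite to that of the path, layer `0` last, so that one would expect each pass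
to uncover at most one more layer, and the end of the path to stay hidden after `p` passes.

*Hiding.* Consider a single layer whose two players alternate with the rest of the world. For each
possible history, whether a player's set is compatible with it is decided by this set alone. With a
few bits of communication, planting an element at a random place hardly decreases the probability of
the history in expectation (`expect_sum_max_sub_plant_le`): by the level-one inequality
(`sum_influence_sq_le`) and a bound on entropy (`sum_negMulLog_le_log_card`), adding the element to
only one of the two sets changes little in Hellinger distance, and by the rectangle property the
same holds for adding it to both (`cut_paste`). The relative decrease of the probability of a
history (`Protocol.loss`) is itself a test function with values in `[0, 1]`, and it only involves
the history up to the last step at which the layer was read. Hence the errors of the layers add up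
rather than multiply (`Protocol.avg_sub_avg_succ_le_mul`), and the end of the path is guessed with
probability at most `1 / m + p * (θ + O(p * S / (θ * m ^ 2)))` for each `θ > 0`
(`Protocol.avg_guess_le`). With `θ` of order `δ / p` this yields `S ≥ c * m ^ 2 / p ^ 3`, which is
of order `n ^ 2 / p ^ 5`.

*The network.* The layers have geometrically decreasing weights. Up to a constant, the weight of a
cut is the sum of the energies of the layers (`cutCost_eq`), and the weights force the source side
of a minimum cut to follow the path, layer by layer (`le_sum_layerEnergy`). The weights of the
edges from the source to the last level encode its vertices, so that the minimum cut value tells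
the end of the path (`isMinCut_netWeight`, `cutValue_injective`). Private copies of the vertices
ensure that each edge depends on the set of one player only, hence an algorithm on the stream is a
protocol of the players (`states_streamProtocol`).

*The other problems.* An algorithm for directed graphs solves the undirected problem, if each edge
is replaced by two opposite ones (`computes_onUndirected`), and the maximum flow value is the
minimum cut value (`IsMaxFlowDirected.isMinCut`, `IsMaxFlowUndirected.isMinCut`). If `n` is not
large compared to `p`, then all that has to be shown is `S ≥ 1` (`Computes.one_le_space`).
-/

namespace HiddenPath

open Finset Function
open scoped BigOperators

/-! ### A set disjointness estimate for random transcripts -/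

section Cube

variable {Q : Type*} [Fintype Q] [DecidableEq Q]

/-- Resampling one coordinate of a uniformly random function does not change expectations. -/
lemma expect_resample {ι α : Type*} [Fintype ι] [DecidableEq ι] [Fintype α] [Nonempty α]
    (i : ι) (G : (ι → α) → ℝ) :
    𝔼 u, G u = 𝔼 u : ι → α, 𝔼 x : α, G (update u i x) := by
  have h : 𝔼 q : (ι → α) × α, G q.1 = 𝔼 q : (ι → α) × α, G (update q.1 i q.2) := by
    -- exchanging the `i`-th coordinate with the fresh sample is an involution
    refine Fintype.expect_equiv
      ⟨fun q => (update q.1 i q.2, q.1 i), fun q => (update q.1 i q.2, q.1 i), ?_, ?_⟩ _ _ ?_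
    · intro q; simp
    · intro q; simp
    · intro q; simp
  have h1 := expect_product (univ : Finset (ι → α)) (univ : Finset α) (fun q => G q.1)
  have h2 := expect_product (univ : Finset (ι → α)) (univ : Finset α)
    (fun q => G (update q.1 i q.2))
  rw [univ_product_univ] at h1 h2
  rw [← h2, ← h, h1]
  simp

lemma expect_bool (g : Bool → ℝ) : 𝔼 x, g x = (g true + g false) / 2 := by
  rw [Fintype.expect_eq_sum_div_card]; simp

lemma expect_cube_split (c : Q) (G : (Q → Bool) → ℝ) :
    𝔼 u, G u = ((𝔼 u, G (update u c true)) + 𝔼 u, G (update u c false)) / 2 := by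
  rw [expect_resample c G]
  simp_rw [expect_bool]
  rw [← expect_add_distrib, expect_div]

lemma expect_prod_cube (g : Q → Bool → ℝ) :
    𝔼 u : Q → Bool, ∏ c, g c (u c) = ∏ c, (g c true + g c false) / 2 := by
  have h := Finset.prod_univ_sum (fun _ : Q => (univ : Finset Bool)) (fun c b => g c b)
  rw [Fintype.expect_eq_sum_div_card]
  rw [Finset.prod_div_distrib]
  simp only [Fintype.sum_bool, Fintype.piFinset_univ] at h
  rw [h]; simp

/-- Level-one inequality: a function of density `α` on the cube has few coordinates on which it
depends noticeably.  Here `χ` is the sign of a bit, and the exponential moment of a linear form is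
compared with its value under the density `F / α`. -/
lemma sum_influence_sq_le (F : (Q → Bool) → ℝ) (h0 : ∀ u, 0 ≤ F u) (h1 : ∀ u, F u ≤ 1) :
    ∑ c, (√(𝔼 u, F (update u c true)) - √(𝔼 u, F (update u c false))) ^ 2
      ≤ 4 * Real.negMulLog (𝔼 u, F u) := by
  set α : ℝ := 𝔼 u, F u with hα
  set p : Bool → Q → ℝ := fun w c => 𝔼 u, F (update u c w) with hp
  have hp0 : ∀ w c, 0 ≤ p w c := fun w c => expect_nonneg fun u _ => h0 _
  have hsplit : ∀ c, α = (p true c + p false c) / 2 := fun c => expect_cube_split c F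
  have hα0 : 0 ≤ α := expect_nonneg fun u _ => h0 _
  rcases hα0.eq_or_lt with hz | hpos
  · have : ∀ c, p true c = 0 ∧ p false c = 0 := by
      intro c
      have := hsplit c; have := hp0 true c; have := hp0 false c
      constructor <;> linarith
    have h2 : ∑ c, (√(p true c) - √(p false c)) ^ 2 = 0 := by
      apply Finset.sum_eq_zero; intro c _; rw [(this c).1, (this c).2]; simp
    change ∑ c, (√(p true c) - √(p false c)) ^ 2 ≤ _
    rw [h2, ← hz]; simp
  set χ : Bool → ℝ := fun b => if b then 1 else -1 with hχ
  set l : Q → ℝ := fun c => (p true c - p false c) / (2 * α) with hl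
  set s : ℝ := ∑ c, l c ^ 2 with hs
  have hmean : ∀ c, 𝔼 u, F u * χ (u c) = α * l c := by
    intro c
    rw [expect_cube_split c]
    simp only [update_self, hχ, if_true, Bool.false_eq_true, if_false, mul_one, mul_neg,
      expect_neg_distrib, hl]
    field_simp
    simp only [hp]; ring
  have hlin : 𝔼 u, F u * ∑ c, l c * χ (u c) = α * s := by
    simp_rw [Finset.mul_sum]
    rw [expect_sum_comm, hs, Finset.mul_sum]
    refine Finset.sum_congr rfl fun c _ => ?_
    have : ∀ u : Q → Bool, F u * (l c * χ (u c)) = l c * (F u * χ (u c)) := fun u => by ring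
    simp_rw [this]
    rw [← mul_expect, hmean]; ring
  -- tangent line of the exponential at `s`
  have hlow : α * Real.exp s ≤ 𝔼 u, F u * Real.exp (∑ c, l c * χ (u c)) := by
    have : ∀ u : Q → Bool, Real.exp s * (F u * (1 - s)) +
        Real.exp s * (F u * ∑ c, l c * χ (u c)) ≤ F u * Real.exp (∑ c, l c * χ (u c)) := by
      intro u
      have h3 := Real.add_one_le_exp ((∑ c, l c * χ (u c)) - s)
      have h4 : Real.exp (∑ c, l c * χ (u c))
          = Real.exp s * Real.exp ((∑ c, l c * χ (u c)) - s) := by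
        rw [← Real.exp_add]; congr 1; ring
      rw [h4]
      have h5 := mul_le_mul_of_nonneg_left h3 (mul_nonneg (h0 u) (Real.exp_pos s).le)
      linarith
    refine le_trans (le_of_eq ?_) (expect_le_expect fun u _ => this u)
    rw [expect_add_distrib, ← mul_expect, ← mul_expect, ← expect_mul, hlin]
    ring
  have hup : 𝔼 u, F u * Real.exp (∑ c, l c * χ (u c)) ≤ Real.exp (s / 2) := by
    have h3 : 𝔼 u, F u * Real.exp (∑ c, l c * χ (u c))
        ≤ 𝔼 u : Q → Bool, ∏ c, Real.exp (l c * χ (u c)) := by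
      refine expect_le_expect fun u _ => ?_
      rw [Real.exp_sum]
      have : 0 ≤ ∏ c, Real.exp (l c * χ (u c)) :=
        Finset.prod_nonneg fun c _ => (Real.exp_pos _).le
      exact mul_le_of_le_one_left this (h1 u)
    refine h3.trans ?_
    rw [expect_prod_cube (fun c b => Real.exp (l c * χ b)), hs, Finset.sum_div, Real.exp_sum]
    refine Finset.prod_le_prod (fun c _ => by positivity) fun c _ => ?_
    have := Real.cosh_le_exp_half_sq (l c)
    rw [Real.cosh_eq] at this
    simpa [hχ] using this
  have hss : s ≤ 2 * (-Real.log α) := by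
    have h3 := Real.log_le_log (by positivity) (hlow.trans hup)
    rw [Real.log_mul hpos.ne' (Real.exp_pos s).ne', Real.log_exp, Real.log_exp] at h3
    linarith
  have hterm : ∀ c, (√(p true c) - √(p false c)) ^ 2 ≤ 2 * α * l c ^ 2 := by
    intro c
    have e1 := Real.sq_sqrt (hp0 true c)
    have e2 := Real.sq_sqrt (hp0 false c)
    have n1 := Real.sqrt_nonneg (p true c)
    have n2 := Real.sqrt_nonneg (p false c)
    set a := √(p true c)
    set b := √(p false c)
    have h5 : 2 * α = a ^ 2 + b ^ 2 := by rw [hsplit c, e1, e2]; ring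
    have h6 : 2 * α * l c ^ 2 * (2 * α) = (a - b) ^ 2 * (a + b) ^ 2 := by
      have : l c * (2 * α) = a ^ 2 - b ^ 2 := by
        simp only [hl]; rw [div_mul_cancel₀ _ (by positivity), e1, e2]
      calc 2 * α * l c ^ 2 * (2 * α) = (l c * (2 * α)) ^ 2 := by ring
        _ = _ := by rw [this]; ring
    have h7 : (a - b) ^ 2 * (2 * α) ≤ (a - b) ^ 2 * (a + b) ^ 2 := by
      apply mul_le_mul_of_nonneg_left _ (sq_nonneg _)
      rw [h5]; nlinarith [mul_nonneg n1 n2]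
    rw [← h6] at h7
    exact le_of_mul_le_mul_right h7 (by positivity)
  calc ∑ c, (√(p true c) - √(p false c)) ^ 2 ≤ ∑ c, 2 * α * l c ^ 2 :=
        Finset.sum_le_sum fun c _ => hterm c
    _ = 2 * α * s := by rw [← Finset.mul_sum]
    _ ≤ 2 * α * (2 * (-Real.log α)) := by gcongr
    _ = 4 * Real.negMulLog α := by rw [Real.negMulLog]; ring

end Cube

section Entropy

variable {J : Type*} [Fintype J]

lemma sum_negMulLog_le_log_card (v : J → ℝ) (h0 : ∀ j, 0 ≤ v j) (h1 : ∑ j, v j = 1) :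
    ∑ j, Real.negMulLog (v j) ≤ Real.log (Fintype.card J) := by
  have hne : Nonempty J := by
    by_contra h
    rw [not_nonempty_iff] at h
    simp at h1
  have hn : (0 : ℝ) < Fintype.card J := by exact_mod_cast Fintype.card_pos
  set n : ℝ := (Fintype.card J : ℝ) with hn_def
  have : ∀ j, Real.negMulLog (v j) ≤ v j * Real.log n + (1 / n - v j) := by
    intro j
    rcases (h0 j).eq_or_lt with hz | hp
    · rw [← hz]; simp; positivity
    · have h2 := Real.log_le_sub_one_of_pos (show 0 < 1 / (n * v j) by positivity)
      rw [one_div, Real.log_inv, Real.log_mul hn.ne' hp.ne'] at h2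
      have h3 := mul_le_mul_of_nonneg_left h2 hp.le
      have h4 : v j * ((n * v j)⁻¹ - 1) = 1 / n - v j := by field_simp
      rw [h4] at h3
      rw [Real.negMulLog]; linarith
  calc ∑ j, Real.negMulLog (v j) ≤ ∑ j, (v j * Real.log n + (1 / n - v j)) :=
        Finset.sum_le_sum fun j _ => this j
    _ = Real.log n := by
        rw [Finset.sum_add_distrib, ← Finset.sum_mul, h1, Finset.sum_sub_distrib, h1]
        simp only [Finset.sum_const, Finset.card_univ, nsmul_eq_mul]
        rw [← hn_def]
        field_simp; ring

/-- The positive part of a difference is controlled by the Hellinger distance. -/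
lemma max_sub_le_hellinger {p q θ : ℝ} (hp : 0 ≤ p) (hq : 0 ≤ q) (hθ : 0 < θ) :
    max (p - q) 0 ≤ (√p - √q) ^ 2 / θ + θ * p := by
  have e1 := Real.sq_sqrt hp
  have e2 := Real.sq_sqrt hq
  have n1 := Real.sqrt_nonneg p
  have n2 := Real.sqrt_nonneg q
  refine max_le ?_ (by positivity)
  set a := √p
  set b := √q
  rw [← e1, ← e2, div_add' _ _ _ hθ.ne', le_div_iff₀ hθ]
  nlinarith [sq_nonneg (a - b - θ * a), sq_nonneg (a - b)]

end Entropy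

section Leaves

variable {Q : Type*} [DecidableEq Q] {J : Type*} [Fintype J]

/-- The bits of `u` at the positions selected by `D`, and `false` elsewhere. -/
def mask (D u : Q → Bool) : Q → Bool := fun c => D c && u c

/-- The pairs of disjoint sets, as a function of uniformly random bits: `D` says which of the two
sets may contain a given element, and the other two components say whether it does.  Given `D`, the
two sets are independent. -/
def basePair (ω : (Q → Bool) × (Q → Bool) × (Q → Bool)) : (Q → Bool) × (Q → Bool) :=
  (mask ω.1 ω.2.1, mask (fun c => !ω.1 c) ω.2.2)

/-- Put the element `c` into both sets. -/
def plant (c : Q) (q : (Q → Bool) × (Q → Bool)) : (Q → Bool) × (Q → Bool) :=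
  (update q.1 c true, update q.2 c true)

lemma update_mask (D u : Q → Bool) (c : Q) (w : Bool) (hD : D c = true) :
    update (mask D u) c w = mask D (update u c w) := by
  funext x
  by_cases h : x = c
  · subst h; simp [mask, hD]
  · simp [mask, h]

lemma update_mask_update (D u : Q → Bool) (c : Q) (w b : Bool) :
    update (mask (update D c b) u) c w = update (mask D u) c w := by
  funext x
  by_cases h : x = c
  · subst h; simp
  · simp [mask, h]

lemma update_mask_of_false (D u : Q → Bool) (c : Q) (hD : D c = false) :
    update (mask D u) c false = mask D u := by
  funext x
  by_cases h : x = c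
  · subst h; simp [mask, hD]
  · simp [h]

variable [Fintype Q]

/-- Expectation of `F` over the random subset of `D`, with the bit at `c` forced to be `w`. -/
noncomputable def forcedMean (F : (Q → Bool) → ℝ) (D : Q → Bool) (c : Q) (w : Bool) : ℝ :=
  𝔼 u, F (update (mask D u) c w)

lemma mean_mask_of_true (F : (Q → Bool) → ℝ) (D : Q → Bool) (c : Q) (hD : D c = true) :
    𝔼 u, F (mask D u) = (forcedMean F D c true + forcedMean F D c false) / 2 := by
  rw [expect_cube_split c]
  simp only [forcedMean, update_mask _ _ _ _ hD]

lemma mean_mask_of_false (F : (Q → Bool) → ℝ) (D : Q → Bool) (c : Q) (hD : D c = false) :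
    𝔼 u, F (mask D u) = forcedMean F D c false := by
  simp only [forcedMean, update_mask_of_false _ _ _ hD]

lemma forcedMean_nonneg {F : (Q → Bool) → ℝ} (h : ∀ u, 0 ≤ F u) (D : Q → Bool) (c : Q) (w : Bool) :
    0 ≤ forcedMean F D c w := expect_nonneg fun _ _ => h _

/-- How much the acceptance probability of `F` on random subsets of `D` depends on whether `c` is
present, as a squared Hellinger distance. -/
noncomputable def influence (F : (Q → Bool) → ℝ) (D : Q → Bool) (c : Q) : ℝ :=
  (√(forcedMean F D c true) - √(forcedMean F D c false)) ^ 2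

lemma influence_nonneg (F : (Q → Bool) → ℝ) (D : Q → Bool) (c : Q) : 0 ≤ influence F D c :=
  sq_nonneg _

lemma influence_update (F : (Q → Bool) → ℝ) (D : Q → Bool) (c : Q) (b : Bool) :
    influence F (update D c b) c = influence F D c := by
  simp only [influence, forcedMean, update_mask_update]

lemma sum_influence_le (F : (Q → Bool) → ℝ) (h0 : ∀ u, 0 ≤ F u) (h1 : ∀ u, F u ≤ 1)
    (D : Q → Bool) :
    ∑ c with D c = true, influence F D c ≤ 4 * Real.negMulLog (𝔼 u, F (mask D u)) := by
  refine le_trans ?_ (sum_influence_sq_le (fun u => F (mask D u)) (fun u => h0 _) fun u => h1 _)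
  refine le_trans (Finset.sum_le_sum (g := fun c => (√(𝔼 u, F (mask D (update u c true))) -
    √(𝔼 u, F (mask D (update u c false)))) ^ 2) ?_) ?_
  · intro c hc
    rw [Finset.mem_filter] at hc
    simp only [influence, forcedMean, update_mask _ _ _ _ hc.2, le_refl]
  · exact Finset.sum_le_sum_of_subset_of_nonneg (Finset.subset_univ _) fun _ _ _ => sq_nonneg _

/-- Cut and paste: two product-form families `α_w β_w'` of probability distributions satisfy
`h(p₀₀, p₁₁) = h(p₀₁, p₁₀)`, so that changing both bits is detected only if changing one of the two
bits, with the other one equal to `0`, is detected. -/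
lemma cut_paste (α₀ α₁ β₀ β₁ : J → ℝ) (ha0 : ∀ j, 0 ≤ α₀ j) (ha1 : ∀ j, 0 ≤ α₁ j)
    (hb0 : ∀ j, 0 ≤ β₀ j) (hb1 : ∀ j, 0 ≤ β₁ j) (h00 : ∑ j, α₀ j * β₀ j = 1)
    (h11 : ∑ j, α₁ j * β₁ j = 1) (h01 : ∑ j, α₀ j * β₁ j = 1) (h10 : ∑ j, α₁ j * β₀ j = 1) :
    ∑ j, (√(α₀ j * β₀ j) - √(α₁ j * β₁ j)) ^ 2 ≤
      2 * ∑ j, (√(α₁ j) - √(α₀ j)) ^ 2 * β₀ j + 2 * ∑ j, α₀ j * (√(β₁ j) - √(β₀ j)) ^ 2 := by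
  have key : ∑ j, (√(α₀ j * β₀ j) - √(α₁ j * β₁ j)) ^ 2
      = ∑ j, (√(α₁ j * β₀ j) - √(α₀ j * β₁ j)) ^ 2 := by
    have : ∀ j, (√(α₀ j * β₀ j) - √(α₁ j * β₁ j)) ^ 2
        = (√(α₁ j * β₀ j) - √(α₀ j * β₁ j)) ^ 2
          + (α₀ j * β₀ j + α₁ j * β₁ j - α₁ j * β₀ j - α₀ j * β₁ j) := by
      intro j
      rw [Real.sqrt_mul (ha0 j), Real.sqrt_mul (ha1 j), Real.sqrt_mul (ha1 j), Real.sqrt_mul (ha0 j)]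
      have e1 := Real.sq_sqrt (ha0 j)
      have e2 := Real.sq_sqrt (ha1 j)
      have e3 := Real.sq_sqrt (hb0 j)
      have e4 := Real.sq_sqrt (hb1 j)
      generalize √(α₀ j) = a at *
      generalize √(α₁ j) = b at *
      generalize √(β₀ j) = c at *
      generalize √(β₁ j) = d at *
      rw [← e1, ← e2, ← e3, ← e4]; ring
    rw [Finset.sum_congr rfl fun j _ => this j, Finset.sum_add_distrib, Finset.sum_sub_distrib,
      Finset.sum_sub_distrib, Finset.sum_add_distrib, h00, h11, h01, h10]
    ring
  rw [key, Finset.mul_sum, Finset.mul_sum, ← Finset.sum_add_distrib]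
  refine Finset.sum_le_sum fun j _ => ?_
  rw [Real.sqrt_mul (ha1 j), Real.sqrt_mul (ha0 j)]
  nth_rewrite 2 [← Real.sq_sqrt (hb0 j)]
  nth_rewrite 3 [← Real.sq_sqrt (ha0 j)]
  nlinarith [sq_nonneg ((√(α₁ j) - √(α₀ j)) * √(β₀ j) + √(α₀ j) * (√(β₁ j) - √(β₀ j)))]

/-- Changing one bit when the other one is `1` is hardly more visible than when it is `0`. -/
lemma one_sided_hellinger (α₀ α₁ β₀ β₁ : J → ℝ) (ha0 : ∀ j, 0 ≤ α₀ j) (ha1 : ∀ j, 0 ≤ α₁ j)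
    (hb0 : ∀ j, 0 ≤ β₀ j) :
    ∑ j, (√(α₁ j * β₀ j) - √(α₁ j * β₁ j)) ^ 2 ≤
      2 * ∑ j, (√(α₁ j) - √(α₀ j)) ^ 2 * β₀ j
        + 2 * ∑ j, (√(α₀ j * β₀ j) - √(α₁ j * β₁ j)) ^ 2 := by
  rw [Finset.mul_sum, Finset.mul_sum, ← Finset.sum_add_distrib]
  refine Finset.sum_le_sum fun j _ => ?_
  rw [Real.sqrt_mul (ha1 j), Real.sqrt_mul (ha0 j), Real.sqrt_mul (ha1 j)]
  nth_rewrite 2 [← Real.sq_sqrt (hb0 j)]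
  nlinarith [sq_nonneg ((√(α₁ j) - √(α₀ j)) * √(β₀ j) -
    (√(α₀ j) * √(β₀ j) - √(α₁ j) * √(β₁ j)))]

lemma sum_max_sub_le_hellinger (p q : J → ℝ) (hp : ∀ j, 0 ≤ p j) (hq : ∀ j, 0 ≤ q j)
    (h1 : ∑ j, p j = 1) {θ : ℝ} (hθ : 0 < θ) :
    ∑ j, max (p j - q j) 0 ≤ (∑ j, (√(p j) - √(q j)) ^ 2) / θ + θ := by
  calc ∑ j, max (p j - q j) 0 ≤ ∑ j, ((√(p j) - √(q j)) ^ 2 / θ + θ * p j) :=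
        Finset.sum_le_sum fun j _ => max_sub_le_hellinger (hp j) (hq j) hθ
    _ = _ := by rw [Finset.sum_add_distrib, ← Finset.mul_sum, h1, Finset.sum_div, mul_one]

/-- The mixture of `p₀₀` and `p₁₀` is close to `p₁₁` if single bit changes next to a `0` are hard to
detect. -/
lemma sum_max_sub_mixture_le (α₀ α₁ β₀ β₁ : J → ℝ) (ha0 : ∀ j, 0 ≤ α₀ j) (ha1 : ∀ j, 0 ≤ α₁ j)
    (hb0 : ∀ j, 0 ≤ β₀ j) (hb1 : ∀ j, 0 ≤ β₁ j) (h00 : ∑ j, α₀ j * β₀ j = 1)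
    (h11 : ∑ j, α₁ j * β₁ j = 1) (h01 : ∑ j, α₀ j * β₁ j = 1) (h10 : ∑ j, α₁ j * β₀ j = 1)
    {θ : ℝ} (hθ : 0 < θ) :
    ∑ j, max ((α₁ j + α₀ j) / 2 * β₀ j - α₁ j * β₁ j) 0 ≤
      θ + 4 / θ * (∑ j, (√(α₁ j) - √(α₀ j)) ^ 2 * β₀ j + ∑ j, α₀ j * (√(β₁ j) - √(β₀ j)) ^ 2) := by
  have c1 := cut_paste α₀ α₁ β₀ β₁ ha0 ha1 hb0 hb1 h00 h11 h01 h10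
  have c2 := one_sided_hellinger α₀ α₁ β₀ β₁ ha0 ha1 hb0
  have m1 := sum_max_sub_le_hellinger (fun j => α₀ j * β₀ j) (fun j => α₁ j * β₁ j)
    (fun j => mul_nonneg (ha0 j) (hb0 j)) (fun j => mul_nonneg (ha1 j) (hb1 j)) h00 hθ
  have m2 := sum_max_sub_le_hellinger (fun j => α₁ j * β₀ j) (fun j => α₁ j * β₁ j)
    (fun j => mul_nonneg (ha1 j) (hb0 j)) (fun j => mul_nonneg (ha1 j) (hb1 j)) h10 hθ
  have hY : 0 ≤ ∑ j, α₀ j * (√(β₁ j) - √(β₀ j)) ^ 2 :=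
    Finset.sum_nonneg fun j _ => mul_nonneg (ha0 j) (sq_nonneg _)
  set X := ∑ j, (√(α₁ j) - √(α₀ j)) ^ 2 * β₀ j
  set Y := ∑ j, α₀ j * (√(β₁ j) - √(β₀ j)) ^ 2
  have hsum : ∑ j, max ((α₁ j + α₀ j) / 2 * β₀ j - α₁ j * β₁ j) 0 ≤
      (∑ j, max (α₀ j * β₀ j - α₁ j * β₁ j) 0 + ∑ j, max (α₁ j * β₀ j - α₁ j * β₁ j) 0) / 2 := by
    rw [← Finset.sum_add_distrib, Finset.sum_div]
    refine Finset.sum_le_sum fun j _ => max_le ?_ (by positivity)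
    have := le_max_left (α₀ j * β₀ j - α₁ j * β₁ j) 0
    have := le_max_left (α₁ j * β₀ j - α₁ j * β₁ j) 0
    linarith
  have d1 := div_le_div_of_nonneg_right c1 hθ.le
  have d2 := div_le_div_of_nonneg_right (c2.trans (add_le_add_right
    (mul_le_mul_of_nonneg_left c1 zero_le_two) _)) hθ.le
  have e1 : (2 * X + 2 * Y) / θ + (2 * X + 2 * (2 * X + 2 * Y)) / θ ≤ 2 * (4 / θ * (X + Y)) := by
    rw [← add_div, ← mul_div_right_comm, mul_div_assoc', div_le_div_iff_of_pos_right hθ]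
    linarith
  linarith

/-- If the rectangles `FA j × FB j` partition the pairs of sets, then for most elements `c` the
distribution of the rectangle that contains a random pair of disjoint sets hardly changes when `c`
is put into both sets. -/
theorem expect_sum_max_sub_plant_le (FA FB : J → (Q → Bool) → ℝ)
    (hA0 : ∀ j a, 0 ≤ FA j a) (hA1 : ∀ j a, FA j a ≤ 1)
    (hB0 : ∀ j a, 0 ≤ FB j a) (hB1 : ∀ j a, FB j a ≤ 1)
    (hpart : ∀ a b, ∑ j, FA j a * FB j b = 1) [Nonempty Q] {θ : ℝ} (hθ : 0 < θ) :
    𝔼 c : Q, ∑ j, max ((𝔼 ω, FA j (basePair ω).1 * FB j (basePair ω).2)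
        - 𝔼 ω, FA j (plant c (basePair ω)).1 * FB j (plant c (basePair ω)).2) 0
      ≤ θ + 64 * Real.log (Fintype.card J) / (θ * Fintype.card Q) := by
  set nt : (Q → Bool) → Q → Bool := fun D c => !D c with hnt
  have nt_update : ∀ D c b, nt (update D c b) = update (nt D) c (!b) := by
    intro D c b; funext x
    by_cases h : x = c
    · subst h; simp [hnt]
    · simp [hnt, h]
  have nt_nt : ∀ D, nt (nt D) = D := fun D => by funext c; simp [hnt]
  -- means conditioned on `D`
  set a : J → (Q → Bool) → ℝ := fun j D => 𝔼 u, FA j (mask D u) with ha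
  set b : J → (Q → Bool) → ℝ := fun j D => 𝔼 u, FB j (mask (nt D) u) with hb
  have ha0 : ∀ j D, 0 ≤ a j D := fun j D => expect_nonneg fun _ _ => hA0 _ _
  have hb0 : ∀ j D, 0 ≤ b j D := fun j D => expect_nonneg fun _ _ => hB0 _ _
  have ha1 : ∀ j D, a j D ≤ 1 := fun j D => expect_le univ_nonempty fun _ _ => hA1 _ _
  have hb1 : ∀ j D, b j D ≤ 1 := fun j D => expect_le univ_nonempty fun _ _ => hB1 _ _
  have hsum : ∀ (f g : (Q → Bool) → Q → Bool),
      ∑ j, (𝔼 u, FA j (f u)) * (𝔼 u, FB j (g u)) = 1 := by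
    intro f g
    have : ∀ j, (𝔼 u, FA j (f u)) * (𝔼 u, FB j (g u)) = 𝔼 u, 𝔼 u', FA j (f u) * FB j (g u') :=
      fun j => by rw [expect_mul_expect]
    simp_rw [this]
    rw [← expect_sum_comm]
    simp_rw [← expect_sum_comm, hpart]
    simp
  have hprod : ∀ (f : (Q → Bool) → (Q → Bool) → Q → Bool) (g : (Q → Bool) → (Q → Bool) → Q → Bool)
      (j : J), 𝔼 ω : (Q → Bool) × (Q → Bool) × (Q → Bool), FA j (f ω.1 ω.2.1) * FB j (g ω.1 ω.2.2)
        = 𝔼 D, (𝔼 u, FA j (f D u)) * (𝔼 u, FB j (g D u)) := by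
    intro f g j
    rw [← univ_product_univ, expect_product]
    refine expect_congr rfl fun D _ => ?_
    rw [← univ_product_univ, expect_product, expect_mul_expect]
  -- the two influences at an element
  set X : Q → (Q → Bool) → ℝ := fun c D => ∑ j, influence (FA j) D c * forcedMean (FB j) (nt D) c false
    with hX
  set Y : Q → (Q → Bool) → ℝ := fun c D => ∑ j, forcedMean (FA j) D c false * influence (FB j) (nt D) c
    with hY
  have hX0 : ∀ c D, 0 ≤ X c D := fun c D => Finset.sum_nonneg fun j _ =>
    mul_nonneg (influence_nonneg _ _ _) (forcedMean_nonneg (hB0 j) _ _ _)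
  have hY0 : ∀ c D, 0 ≤ Y c D := fun c D => Finset.sum_nonneg fun j _ =>
    mul_nonneg (forcedMean_nonneg (hA0 j) _ _ _) (influence_nonneg _ _ _)
  have hloc : ∀ c D, ∑ j, max (a j D * b j D
      - forcedMean (FA j) D c true * forcedMean (FB j) (nt D) c true) 0
      ≤ θ + 4 / θ * (X c D + Y c D) := by
    intro c D
    cases hD : D c with
    | true =>
      have hD' : nt D c = false := by simp [hnt, hD]
      have := sum_max_sub_mixture_le (fun j => forcedMean (FA j) D c false)
        (fun j => forcedMean (FA j) D c true) (fun j => forcedMean (FB j) (nt D) c false)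
        (fun j => forcedMean (FB j) (nt D) c true) (fun j => forcedMean_nonneg (hA0 j) _ _ _)
        (fun j => forcedMean_nonneg (hA0 j) _ _ _) (fun j => forcedMean_nonneg (hB0 j) _ _ _)
        (fun j => forcedMean_nonneg (hB0 j) _ _ _) (hsum _ _) (hsum _ _) (hsum _ _) (hsum _ _) hθ
      simp only [ha, hb, mean_mask_of_true _ _ _ hD, mean_mask_of_false _ _ _ hD']
      exact this
    | false =>
      have hD' : nt D c = true := by simp [hnt, hD]
      have hs' : ∀ (f g : (Q → Bool) → Q → Bool),
          ∑ j, (𝔼 u, FB j (g u)) * (𝔼 u, FA j (f u)) = 1 := by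
        intro f g; rw [← hsum f g]; exact Finset.sum_congr rfl fun j _ => mul_comm _ _
      have := sum_max_sub_mixture_le (fun j => forcedMean (FB j) (nt D) c false)
        (fun j => forcedMean (FB j) (nt D) c true) (fun j => forcedMean (FA j) D c false)
        (fun j => forcedMean (FA j) D c true) (fun j => forcedMean_nonneg (hB0 j) _ _ _)
        (fun j => forcedMean_nonneg (hB0 j) _ _ _) (fun j => forcedMean_nonneg (hA0 j) _ _ _)
        (fun j => forcedMean_nonneg (hA0 j) _ _ _) (hs' _ _) (hs' _ _) (hs' _ _) (hs' _ _) hθ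
      simp only [ha, hb, mean_mask_of_true _ _ _ hD', mean_mask_of_false _ _ _ hD]
      refine le_trans (le_of_eq ?_) (this.trans (le_of_eq ?_))
      · refine Finset.sum_congr rfl fun j _ => ?_
        rw [mul_comm (forcedMean (FA j) D c false),
          mul_comm (forcedMean (FA j) D c true)]
      · rw [add_comm (X c D)]
        simp only [hX, hY, influence]
        congr 3
        · exact Finset.sum_congr rfl fun j _ => mul_comm _ _
        · exact Finset.sum_congr rfl fun j _ => mul_comm _ _
  -- total influence for fixed `D`, over the elements which the respective set may contain
  have hent : ∀ D, ∑ j, Real.negMulLog (a j D * b j D) ≤ Real.log (Fintype.card J) := fun D =>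
    sum_negMulLog_le_log_card _ (fun j => mul_nonneg (ha0 _ _) (hb0 _ _)) (hsum _ _)
  have hneg : ∀ x y : ℝ, 0 ≤ x → x ≤ 1 → 0 ≤ y → y ≤ 1 →
      Real.negMulLog x * y ≤ Real.negMulLog (x * y) := by
    intro x y hx hx1 hy hy1
    rw [Real.negMulLog_mul]
    have := mul_nonneg hx (Real.negMulLog_nonneg hy hy1)
    linarith
  have hXsum : ∀ D, ∑ c with D c = true, X c D ≤ 4 * Real.log (Fintype.card J) := by
    intro D
    refine le_trans ?_ (mul_le_mul_of_nonneg_left (hent D) (by norm_num))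
    have : ∑ c with D c = true, X c D
        = ∑ j, (∑ c with D c = true, influence (FA j) D c) * b j D := by
      simp only [hX, Finset.sum_mul]
      rw [Finset.sum_comm]
      refine Finset.sum_congr rfl fun j _ => Finset.sum_congr rfl fun c hc => ?_
      rw [Finset.mem_filter] at hc
      have hD' : nt D c = false := by simp [hnt, hc.2]
      simp only [hb, mean_mask_of_false _ _ _ hD']
    rw [this, Finset.mul_sum]
    refine Finset.sum_le_sum fun j _ => ?_
    have h1 := mul_le_mul_of_nonneg_right (sum_influence_le (FA j) (hA0 j) (hA1 j) D) (hb0 j D)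
    have h2 := hneg (a j D) (b j D) (ha0 _ _) (ha1 _ _) (hb0 _ _) (hb1 _ _)
    simp only [ha] at h2 ⊢
    linarith
  have hYsum : ∀ D, ∑ c with D c = false, Y c D ≤ 4 * Real.log (Fintype.card J) := by
    intro D
    refine le_trans ?_ (mul_le_mul_of_nonneg_left (hent D) (by norm_num))
    have : ∑ c with D c = false, Y c D
        = ∑ j, (∑ c with nt D c = true, influence (FB j) (nt D) c) * a j D := by
      simp only [hY, Finset.sum_mul]
      rw [Finset.sum_comm]
      refine Finset.sum_congr rfl fun j _ => ?_
      have hf : (univ.filter fun c => nt D c = true) = univ.filter fun c => D c = false := by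
        ext c; simp [hnt]
      rw [hf]
      refine Finset.sum_congr rfl fun c hc => ?_
      rw [Finset.mem_filter] at hc
      simp only [ha, mean_mask_of_false _ _ _ hc.2]
      exact mul_comm _ _
    rw [this, Finset.mul_sum]
    refine Finset.sum_le_sum fun j _ => ?_
    have h1 := mul_le_mul_of_nonneg_right (sum_influence_le (FB j) (hB0 j) (hB1 j) (nt D)) (ha0 j D)
    have h2 := hneg (b j D) (a j D) (hb0 _ _) (hb1 _ _) (ha0 _ _) (ha1 _ _)
    rw [mul_comm (b j D)] at h2
    simp only [hb] at h2 ⊢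
    linarith
  -- the influences at `c` do not depend on the bit `D c`
  have hXinv : ∀ c D v, X c (update D c v) = X c D := by
    intro c D v
    simp only [hX, nt_update, influence_update, forcedMean, update_mask_update]
  have hYinv : ∀ c D v, Y c (update D c v) = Y c D := by
    intro c D v
    simp only [hY, nt_update, influence_update, forcedMean, update_mask_update]
  have hhalf : ∀ (Z : (Q → Bool) → ℝ) (c : Q) (w : Bool), (∀ D v, Z (update D c v) = Z D) →
      𝔼 D, Z D = 2 * 𝔼 D : Q → Bool, if D c = w then Z D else 0 := by
    intro Z c w hZ
    rw [expect_cube_split c fun D : Q → Bool => if D c = w then Z D else 0]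
    cases w <;> simp [hZ] <;> ring
  have hXtot : ∑ c, 𝔼 D, X c D ≤ 8 * Real.log (Fintype.card J) := by
    have : ∑ c, 𝔼 D, X c D = 2 * 𝔼 D : Q → Bool, ∑ c with D c = true, X c D := by
      simp_rw [Finset.sum_filter]
      rw [expect_sum_comm, Finset.mul_sum]
      exact Finset.sum_congr rfl fun c _ => hhalf _ c true (hXinv c)
    have h2 := expect_le (s := univ) (univ_nonempty (α := Q → Bool)) fun D _ => hXsum D
    linarith
  have hYtot : ∑ c, 𝔼 D, Y c D ≤ 8 * Real.log (Fintype.card J) := by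
    have : ∑ c, 𝔼 D, Y c D = 2 * 𝔼 D : Q → Bool, ∑ c with D c = false, Y c D := by
      simp_rw [Finset.sum_filter]
      rw [expect_sum_comm, Finset.mul_sum]
      exact Finset.sum_congr rfl fun c _ => hhalf _ c false (hYinv c)
    have h2 := expect_le (s := univ) (univ_nonempty (α := Q → Bool)) fun D _ => hYsum D
    linarith
  -- averaging over `D` only decreases the positive part
  have hc : ∀ c, ∑ j, max ((𝔼 ω, FA j (basePair ω).1 * FB j (basePair ω).2)
        - 𝔼 ω, FA j (plant c (basePair ω)).1 * FB j (plant c (basePair ω)).2) 0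
      ≤ θ + 4 / θ * ((𝔼 D, X c D) + 𝔼 D, Y c D) := by
    intro c
    have h1 : ∀ j, 𝔼 ω, FA j (basePair ω).1 * FB j (basePair ω).2 = 𝔼 D, a j D * b j D :=
      fun j => hprod (fun D u => mask D u) (fun D u => mask (nt D) u) j
    have h2 : ∀ j, 𝔼 ω, FA j (plant c (basePair ω)).1 * FB j (plant c (basePair ω)).2
        = 𝔼 D, forcedMean (FA j) D c true * forcedMean (FB j) (nt D) c true :=
      fun j => hprod (fun D u => update (mask D u) c true) (fun D u => update (mask (nt D) u) c true) j
    simp_rw [h1, h2, ← expect_sub_distrib]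
    calc ∑ j, max (𝔼 D, (a j D * b j D
            - forcedMean (FA j) D c true * forcedMean (FB j) (nt D) c true)) 0
        ≤ ∑ j, 𝔼 D, max (a j D * b j D
            - forcedMean (FA j) D c true * forcedMean (FB j) (nt D) c true) 0 := by
          refine Finset.sum_le_sum fun j _ => max_le ?_ ?_
          · exact expect_le_expect fun D _ => le_max_left _ _
          · exact expect_nonneg fun D _ => le_max_right _ _
      _ = 𝔼 D, ∑ j, max (a j D * b j D
            - forcedMean (FA j) D c true * forcedMean (FB j) (nt D) c true) 0 := by
          rw [expect_sum_comm]
      _ ≤ 𝔼 D, (θ + 4 / θ * (X c D + Y c D)) := expect_le_expect fun D _ => hloc c D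
      _ = θ + 4 / θ * ((𝔼 D, X c D) + 𝔼 D, Y c D) := by
          rw [expect_add_distrib, ← mul_expect, expect_add_distrib, expect_const univ_nonempty]
  have hN : (0 : ℝ) < Fintype.card Q := by exact_mod_cast Fintype.card_pos
  calc _ ≤ 𝔼 c, (θ + 4 / θ * ((𝔼 D, X c D) + 𝔼 D, Y c D)) := expect_le_expect fun c _ => hc c
    _ = θ + 4 / θ * ((∑ c, 𝔼 D, X c D + ∑ c, 𝔼 D, Y c D) / Fintype.card Q) := by
        rw [expect_add_distrib, ← mul_expect, expect_const univ_nonempty,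
          Fintype.expect_eq_sum_div_card, Finset.sum_add_distrib]
    _ ≤ θ + 4 / θ * ((8 * Real.log (Fintype.card J) + 8 * Real.log (Fintype.card J))
          / Fintype.card Q) := by gcongr
    _ = _ := by field_simp; ring

end Leaves

/-! ### Chasing a hidden path with few rounds -/

/-- A protocol in which a shared memory with values in `M` is updated by the players in turn.
There are `k` layers with two players each, and every player holds a subset of `Q`. -/
structure Protocol (k : ℕ) (Q M : Type) where
  /-- initial content of the memory -/
  init : M
  /-- the player who updates the memory in a given step -/
  turn : ℕ → Fin k × Bool
  /-- the new content of the memory, given the step, the player's set and the old content -/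
  next : ℕ → (Q → Bool) → M → M

namespace Protocol

variable {k : ℕ} {Q M : Type} (π : Protocol k Q M)

/-- The contents of the memory in the course of time. -/
def states (I : Fin k × Bool → Q → Bool) : ℕ → M
  | 0 => π.init
  | t + 1 => π.next t (I (π.turn t)) (states I t)

open scoped Classical in
/-- `1` if the first `T` steps of the history `γ` are consistent with player `P` holding `a`. -/
noncomputable def accepts (P : Fin k × Bool) (T : ℕ) (γ : ℕ → M) (a : Q → Bool) : ℝ :=
  if ∀ t < T, π.turn t = P → γ (t + 1) = π.next t a (γ t) then 1 else 0

lemma accepts_nonneg (P : Fin k × Bool) (T : ℕ) (γ : ℕ → M) (a : Q → Bool) :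
    0 ≤ π.accepts P T γ a := by
  unfold accepts; split_ifs <;> norm_num

lemma accepts_le_one (P : Fin k × Bool) (T : ℕ) (γ : ℕ → M) (a : Q → Bool) :
    π.accepts P T γ a ≤ 1 := by
  unfold accepts; split_ifs <;> norm_num

lemma accepts_congr (P : Fin k × Bool) {T : ℕ} {γ γ' : ℕ → M} (h : ∀ t ≤ T, γ t = γ' t) :
    π.accepts P T γ = π.accepts P T γ' := by
  funext a
  unfold accepts
  have : (∀ t < T, π.turn t = P → γ (t + 1) = π.next t a (γ t)) ↔
      ∀ t < T, π.turn t = P → γ' (t + 1) = π.next t a (γ' t) :=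
    forall₂_congr fun t ht => by rw [h t ht.le, h (t + 1) ht]
  classical exact if_congr this rfl rfl

lemma accepts_eq_of_not_turn (P : Fin k × Bool) {T T' : ℕ} (hT : T ≤ T')
    (h : ∀ t, T ≤ t → t < T' → π.turn t ≠ P) (γ : ℕ → M) :
    π.accepts P T' γ = π.accepts P T γ := by
  funext a
  unfold accepts
  have : (∀ t < T', π.turn t = P → γ (t + 1) = π.next t a (γ t)) ↔
      ∀ t < T, π.turn t = P → γ (t + 1) = π.next t a (γ t) := by
    constructor
    · exact fun H t ht => H t (by omega)
    · intro H t ht hP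
      by_cases h' : t < T
      · exact H t h' hP
      · exact absurd hP (h t (by omega) ht)
  classical exact if_congr this rfl rfl

/-- Replace the two sets of layer `i`. -/
def setLayer (I : Fin k × Bool → Q → Bool) (i : Fin k) (q : (Q → Bool) × (Q → Bool)) :
    Fin k × Bool → Q → Bool :=
  fun P => if P.1 = i then (if P.2 then q.2 else q.1) else I P

/-- A history of `T` steps, continued constantly. -/
def extend {T : ℕ} (γ : Fin (T + 1) → M) : ℕ → M := fun t => γ ⟨min t T, by omega⟩

lemma extend_apply {T : ℕ} (γ : Fin (T + 1) → M) (t : Fin (T + 1)) : extend γ t = γ t := by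
  unfold extend
  congr 1
  ext
  simp; omega

/-- The histories of `T` steps in which every step of a player outside layer `i` is the one
prescribed by the sets `I`. -/
abbrev Leaf (i : Fin k) (I : Fin k × Bool → Q → Bool) (T : ℕ) : Type :=
  {γ : Fin (T + 1) → M // extend γ 0 = π.init ∧ ∀ t < T, (π.turn t).1 ≠ i →
    extend γ (t + 1) = π.next t (I (π.turn t)) (extend γ t)}

noncomputable instance [Fintype M] (i : Fin k) (I : Fin k × Bool → Q → Bool) (T : ℕ) :
    Fintype (π.Leaf i I T) := by
  classical exact inferInstanceAs (Fintype {γ : Fin (T + 1) → M // _})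

/-- A leaf is determined by the messages of layer `i`. -/
lemma card_leaf_le [Fintype M] (i : Fin k) (I : Fin k × Bool → Q → Bool) (T : ℕ) :
    Fintype.card (π.Leaf i I T)
      ≤ Fintype.card M ^ ((range T).filter fun t => (π.turn t).1 = i).card := by
  classical
  set s := (range T).filter fun t => (π.turn t).1 = i with hs
  have hinj : Injective fun (γ : π.Leaf i I T) (t : s) => extend γ.1 (t.1 + 1) := by
    intro γ γ' h
    have key : ∀ t ≤ T, extend γ.1 t = extend γ'.1 t := by
      intro t
      induction t with
      | zero => intro _; rw [γ.2.1, γ'.2.1]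
      | succ t ih =>
        intro ht
        by_cases hi : (π.turn t).1 = i
        · exact congrFun h ⟨t, by simp [hs, hi]; omega⟩
        · rw [γ.2.2 t (by omega) hi, γ'.2.2 t (by omega) hi, ih (by omega)]
    apply Subtype.ext
    funext t
    rw [← extend_apply γ.1 t, ← extend_apply γ'.1 t]
    exact key t (by omega)
  have := Fintype.card_le_of_injective _ hinj
  simpa using this

/-- Sum over the leaves: exactly one leaf is accepted by both players of layer `i`. -/
lemma sum_leaf [Fintype M] (i : Fin k) (I : Fin k × Bool → Q → Bool) (T : ℕ)
    (Ψ : (ℕ → M) → ℝ) (hΨ : ∀ γ γ' : ℕ → M, (∀ t ≤ T, γ t = γ' t) → Ψ γ = Ψ γ')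
    (a b : Q → Bool) :
    ∑ γ : π.Leaf i I T, Ψ (extend γ.1) *
        (π.accepts (i, false) T (extend γ.1) a * π.accepts (i, true) T (extend γ.1) b)
      = Ψ (π.states (setLayer I i (a, b))) := by
  classical
  set σ := π.states (setLayer I i (a, b)) with hσ
  have hstep : ∀ t, σ (t + 1) = π.next t (setLayer I i (a, b) (π.turn t)) (σ t) := fun t => rfl
  let γ₀ : Fin (T + 1) → M := fun t => σ t
  have hγ₀ : ∀ t ≤ T, extend γ₀ t = σ t := by
    intro t ht
    simp only [extend, γ₀, min_eq_left ht]
  have hmem : extend γ₀ 0 = π.init ∧ ∀ t < T, (π.turn t).1 ≠ i →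
      extend γ₀ (t + 1) = π.next t (I (π.turn t)) (extend γ₀ t) := by
    refine ⟨by rw [hγ₀ 0 (by omega)]; rfl, fun t ht hi => ?_⟩
    rw [hγ₀ _ ht, hγ₀ _ ht.le, hstep, setLayer, if_neg hi]
  have hA : π.accepts (i, false) T (extend γ₀) a = 1 := by
    unfold accepts
    rw [if_pos]
    intro t ht hP
    rw [hγ₀ _ ht, hγ₀ _ ht.le, hstep, setLayer, hP]
    simp
  have hB : π.accepts (i, true) T (extend γ₀) b = 1 := by
    unfold accepts
    rw [if_pos]
    intro t ht hP
    rw [hγ₀ _ ht, hγ₀ _ ht.le, hstep, setLayer, hP]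
    simp
  rw [Finset.sum_eq_single (⟨γ₀, hmem⟩ : π.Leaf i I T)]
  · rw [hA, hB, mul_one, mul_one]
    exact hΨ _ _ hγ₀
  · intro γ _ hne
    by_contra hnz
    apply hne
    have h1 : ∀ t < T, π.turn t = (i, false) →
        extend γ.1 (t + 1) = π.next t a (extend γ.1 t) := by
      by_contra h
      apply hnz; simp [accepts, h]
    have h2 : ∀ t < T, π.turn t = (i, true) →
        extend γ.1 (t + 1) = π.next t b (extend γ.1 t) := by
      by_contra h
      apply hnz; simp [accepts, h]
    have key : ∀ t ≤ T, extend γ.1 t = σ t := by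
      intro t
      induction t with
      | zero => intro _; rw [γ.2.1]; rfl
      | succ t ih =>
        intro ht
        have ih := ih (by omega)
        rw [hstep]
        by_cases hi : (π.turn t).1 = i
        · cases hb : (π.turn t).2 with
          | false =>
            rw [h1 t (by omega) (Prod.ext hi hb), ih]; simp [setLayer, hi, hb]
          | true =>
            rw [h2 t (by omega) (Prod.ext hi hb), ih]; simp [setLayer, hi, hb]
        · rw [γ.2.2 t (by omega) hi, ih]; simp [setLayer, hi]
    apply Subtype.ext
    funext t
    rw [← extend_apply γ.1 t]
    exact key t (by omega)
  · intro h; exact absurd (Finset.mem_univ _) h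

variable [Fintype Q] [DecidableEq Q]

/-- The probability that the history `γ` is consistent with random disjoint sets in layer `i`. -/
noncomputable def baseProb (i : Fin k) (T : ℕ) (γ : ℕ → M) : ℝ :=
  𝔼 ω : (Q → Bool) × (Q → Bool) × (Q → Bool),
    π.accepts (i, false) T γ (basePair ω).1 * π.accepts (i, true) T γ (basePair ω).2

/-- The same probability after `c` has been put into both sets. -/
noncomputable def plantProb (i : Fin k) (T : ℕ) (c : Q) (γ : ℕ → M) : ℝ :=
  𝔼 ω : (Q → Bool) × (Q → Bool) × (Q → Bool),
    π.accepts (i, false) T γ (plant c (basePair ω)).1 *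
      π.accepts (i, true) T γ (plant c (basePair ω)).2

/-- The relative loss of probability of the history `γ` when `c` is put into both sets.  Its values
are in `[0, 1]`, so that it can serve as a test function itself. -/
noncomputable def loss (i : Fin k) (T : ℕ) (c : Q) (γ : ℕ → M) : ℝ :=
  max (π.baseProb i T γ - π.plantProb i T c γ) 0 / π.baseProb i T γ

lemma baseProb_nonneg (i : Fin k) (T : ℕ) (γ : ℕ → M) : 0 ≤ π.baseProb i T γ :=
  expect_nonneg fun _ _ => mul_nonneg (π.accepts_nonneg _ _ _ _) (π.accepts_nonneg _ _ _ _)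

lemma plantProb_nonneg (i : Fin k) (T : ℕ) (c : Q) (γ : ℕ → M) : 0 ≤ π.plantProb i T c γ :=
  expect_nonneg fun _ _ => mul_nonneg (π.accepts_nonneg _ _ _ _) (π.accepts_nonneg _ _ _ _)

lemma loss_nonneg (i : Fin k) (T : ℕ) (c : Q) (γ : ℕ → M) : 0 ≤ π.loss i T c γ :=
  div_nonneg (le_max_right _ _) (π.baseProb_nonneg _ _ _)

lemma loss_le_one (i : Fin k) (T : ℕ) (c : Q) (γ : ℕ → M) : π.loss i T c γ ≤ 1 := by
  refine div_le_one_of_le₀ (max_le ?_ (π.baseProb_nonneg _ _ _)) (π.baseProb_nonneg _ _ _)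
  linarith [π.plantProb_nonneg i T c γ]

lemma loss_mul_baseProb (i : Fin k) (T : ℕ) (c : Q) (γ : ℕ → M) :
    π.loss i T c γ * π.baseProb i T γ = max (π.baseProb i T γ - π.plantProb i T c γ) 0 := by
  unfold loss
  rcases (π.baseProb_nonneg i T γ).eq_or_lt with h | h
  · rw [← h, mul_zero, max_eq_right]
    linarith [π.plantProb_nonneg i T c γ]
  · rw [div_mul_cancel₀ _ h.ne']

lemma baseProb_congr (i : Fin k) {T : ℕ} {γ γ' : ℕ → M} (h : ∀ t ≤ T, γ t = γ' t) :
    π.baseProb i T γ = π.baseProb i T γ' := by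
  unfold baseProb
  rw [π.accepts_congr (i, false) h, π.accepts_congr (i, true) h]

lemma plantProb_congr (i : Fin k) {T : ℕ} (c : Q) {γ γ' : ℕ → M} (h : ∀ t ≤ T, γ t = γ' t) :
    π.plantProb i T c γ = π.plantProb i T c γ' := by
  unfold plantProb
  rw [π.accepts_congr (i, false) h, π.accepts_congr (i, true) h]

lemma loss_congr (i : Fin k) {T : ℕ} (c : Q) {γ γ' : ℕ → M} (h : ∀ t ≤ T, γ t = γ' t) :
    π.loss i T c γ = π.loss i T c γ' := by
  unfold loss
  rw [π.baseProb_congr i h, π.plantProb_congr i c h]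

lemma expect_base_eq_sum_leaf [Fintype M] (i : Fin k) (I : Fin k × Bool → Q → Bool) (T : ℕ)
    (Ψ : (ℕ → M) → ℝ) (hΨ : ∀ γ γ' : ℕ → M, (∀ t ≤ T, γ t = γ' t) → Ψ γ = Ψ γ') :
    𝔼 ω, Ψ (π.states (setLayer I i (basePair ω)))
      = ∑ γ : π.Leaf i I T, Ψ (extend γ.1) * π.baseProb i T (extend γ.1) := by
  simp only [← π.sum_leaf i I T Ψ hΨ, baseProb, mul_expect]
  rw [expect_sum_comm]

lemma expect_plant_eq_sum_leaf [Fintype M] (i : Fin k) (I : Fin k × Bool → Q → Bool) (T : ℕ)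
    (c : Q) (Ψ : (ℕ → M) → ℝ) (hΨ : ∀ γ γ' : ℕ → M, (∀ t ≤ T, γ t = γ' t) → Ψ γ = Ψ γ') :
    𝔼 ω, Ψ (π.states (setLayer I i (plant c (basePair ω))))
      = ∑ γ : π.Leaf i I T, Ψ (extend γ.1) * π.plantProb i T c (extend γ.1) := by
  simp only [← π.sum_leaf i I T Ψ hΨ, plantProb, mul_expect]
  rw [expect_sum_comm]

/-- A test function with values in `[0, 1]` cannot tell the planted layer `i` from the original one
better than the expected loss, which only involves the history up to the last step of layer `i`. -/
lemma expect_base_sub_plant_le [Fintype M] (i : Fin k) (I : Fin k × Bool → Q → Bool) {T T' : ℕ}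
    (hT : T ≤ T') (hturn : ∀ t, T ≤ t → t < T' → (π.turn t).1 ≠ i) (c : Q)
    (Φ : (ℕ → M) → ℝ) (h0 : ∀ γ, 0 ≤ Φ γ) (h1 : ∀ γ, Φ γ ≤ 1)
    (hΦ : ∀ γ γ' : ℕ → M, (∀ t ≤ T', γ t = γ' t) → Φ γ = Φ γ') :
    (𝔼 ω, Φ (π.states (setLayer I i (basePair ω))))
        - 𝔼 ω, Φ (π.states (setLayer I i (plant c (basePair ω))))
      ≤ 𝔼 ω, π.loss i T c (π.states (setLayer I i (basePair ω))) := by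
  have hacc : ∀ b γ, π.accepts (i, b) T' γ = π.accepts (i, b) T γ := fun b γ =>
    π.accepts_eq_of_not_turn (i, b) hT (fun t h h' e => hturn t h h' (by rw [e])) γ
  have hb : ∀ γ, π.baseProb i T' γ = π.baseProb i T γ := fun γ => by
    unfold baseProb; simp only [hacc]
  have hp : ∀ γ, π.plantProb i T' c γ = π.plantProb i T c γ := fun γ => by
    unfold plantProb; simp only [hacc]
  have hl : ∀ γ, π.loss i T' c γ = π.loss i T c γ := fun γ => by unfold loss; simp only [hb, hp]
  rw [π.expect_base_eq_sum_leaf i I T' Φ hΦ, π.expect_plant_eq_sum_leaf i I T' c Φ hΦ,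
    π.expect_base_eq_sum_leaf i I T' (π.loss i T c) fun γ γ' h => by
      rw [← hl, ← hl]; exact π.loss_congr i c h,
    ← Finset.sum_sub_distrib]
  refine Finset.sum_le_sum fun γ _ => ?_
  rw [← hl, loss_mul_baseProb, ← mul_sub]
  set d := π.baseProb i T' (extend γ.1) - π.plantProb i T' c (extend γ.1)
  calc Φ (extend γ.1) * d ≤ Φ (extend γ.1) * max d 0 :=
        mul_le_mul_of_nonneg_left (le_max_left _ _) (h0 _)
    _ ≤ max d 0 := mul_le_of_le_one_left (le_max_right _ _) (h1 _)

/-- If layer `i` is unplanted and the place of the planted element is independent of everything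
else, then the expected loss is small. -/
lemma expect_loss_le [Fintype M] [Nonempty Q] (i : Fin k) (I : Fin k × Bool → Q → Bool) (T : ℕ)
    {N : ℕ} (hN : ((range T).filter fun t => (π.turn t).1 = i).card ≤ N) {θ : ℝ} (hθ : 0 < θ) :
    𝔼 c, 𝔼 ω, π.loss i T c (π.states (setLayer I i (basePair ω)))
      ≤ θ + 64 * (N * Real.log (Fintype.card M)) / (θ * Fintype.card Q) := by
  have hM : 1 ≤ Fintype.card M := Fintype.card_pos_iff.mpr ⟨π.init⟩
  have hpart : ∀ a b, ∑ γ : π.Leaf i I T, π.accepts (i, false) T (extend γ.1) a *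
      π.accepts (i, true) T (extend γ.1) b = 1 := by
    intro a b
    have := π.sum_leaf i I T (fun _ => 1) (fun _ _ _ => rfl) a b
    simpa using this
  have hne : Nonempty (π.Leaf i I T) := by
    by_contra h
    rw [not_nonempty_iff] at h
    have := hpart (fun _ => false) (fun _ => false)
    simp at this
  have key := expect_sum_max_sub_plant_le
    (fun γ : π.Leaf i I T => π.accepts (i, false) T (extend γ.1))
    (fun γ : π.Leaf i I T => π.accepts (i, true) T (extend γ.1))
    (fun _ => π.accepts_nonneg _ _ _) (fun _ => π.accepts_le_one _ _ _)
    (fun _ => π.accepts_nonneg _ _ _) (fun _ => π.accepts_le_one _ _ _) hpart hθ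
  have hlog : Real.log (Fintype.card (π.Leaf i I T)) ≤ N * Real.log (Fintype.card M) := by
    have h1 := (π.card_leaf_le i I T).trans (Nat.pow_le_pow_right hM hN)
    rw [← Real.log_pow]
    refine Real.log_le_log (by exact_mod_cast Fintype.card_pos) (by exact_mod_cast h1)
  refine le_trans (le_of_eq ?_) (key.trans ?_)
  · refine expect_congr rfl fun c _ => ?_
    rw [π.expect_base_eq_sum_leaf i I T (π.loss i T c) fun γ γ' h => π.loss_congr i c h]
    exact Finset.sum_congr rfl fun γ _ => π.loss_mul_baseProb i T c _
  · gcongr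

end Protocol

namespace Protocol

variable {k : ℕ} {X M : Type} [DecidableEq X]

/-- The random bits that determine the unplanted sets of all layers. -/
abbrev Seeds (k : ℕ) (X : Type) : Type :=
  Fin k → (X × X → Bool) × (X × X → Bool) × (X × X → Bool)

/-- The element that the path `x₀, z 1, …, z k` picks in layer `i`; the value `z 0` plays no role. -/
def pathCell (x₀ : X) (z : Fin (k + 1) → X) (i : Fin k) : X × X :=
  (if i.val = 0 then x₀ else z i.castSucc, z i.succ)

/-- The sets of all players, where the path has been planted into the layers below `j`. -/
def inputs (x₀ : X) (j : ℕ) (z : Fin (k + 1) → X) (ω : Seeds k X) (P : Fin k × Bool) :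
    X × X → Bool :=
  let q := if P.1.val < j then plant (pathCell x₀ z P.1) (basePair (ω P.1)) else basePair (ω P.1)
  if P.2 then q.2 else q.1

variable (x₀ : X)

lemma inputs_update_base {j : ℕ} {i : Fin k} (hj : j ≤ i.val) (z : Fin (k + 1) → X)
    (ω : Seeds k X) (ω' : (X × X → Bool) × (X × X → Bool) × (X × X → Bool)) :
    inputs x₀ j z (update ω i ω') = setLayer (inputs x₀ j z ω) i (basePair ω') := by
  funext P
  by_cases h : P.1 = i
  · have : ¬ P.1.val < j := by rw [h]; omega
    simp only [inputs, setLayer, if_pos h, if_neg this]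
    rw [h, update_self]
  · simp only [inputs, setLayer, if_neg h, update_of_ne h]

lemma inputs_update_plant (i : Fin k) (z : Fin (k + 1) → X)
    (ω : Seeds k X) (ω' : (X × X → Bool) × (X × X → Bool) × (X × X → Bool)) :
    inputs x₀ (i.val + 1) z (update ω i ω')
      = setLayer (inputs x₀ i.val z ω) i (plant (pathCell x₀ z i) (basePair ω')) := by
  funext P
  by_cases h : P.1 = i
  · have : P.1.val < i.val + 1 := by rw [h]; omega
    simp only [inputs, setLayer, if_pos h, if_pos this]
    rw [h, update_self]
  · have hne : P.1.val ≠ i.val := fun e => h (Fin.ext e)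
    have : P.1.val < i.val + 1 ↔ P.1.val < i.val := by omega
    simp only [inputs, setLayer, if_neg h, update_of_ne h, this]

lemma inputs_congr {j : ℕ} {z z' : Fin (k + 1) → X} (h : ∀ l : Fin (k + 1), l.val ≤ j → z l = z' l)
    (ω : Seeds k X) : inputs x₀ j z ω = inputs x₀ j z' ω := by
  funext P
  simp only [inputs]
  by_cases hP : P.1.val < j
  · have : pathCell x₀ z P.1 = pathCell x₀ z' P.1 := by
      unfold pathCell
      rw [h P.1.castSucc (by simp; omega), h P.1.succ (by simp; omega)]
    rw [this]
  · simp only [if_neg hP]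

variable [Fintype X]

/-- The expectation of a test function of the path and the history. -/
noncomputable def avg (π : Protocol k (X × X) M) (x₀ : X) (j : ℕ)
    (Φ : (Fin (k + 1) → X) → (ℕ → M) → ℝ) : ℝ :=
  𝔼 z : Fin (k + 1) → X, 𝔼 ω : Seeds k X, Φ z (π.states (inputs x₀ j z ω))

variable (π : Protocol k (X × X) M)

lemma avg_one_sub [Nonempty X] (j : ℕ) (Φ : (Fin (k + 1) → X) → (ℕ → M) → ℝ) :
    π.avg x₀ j (fun z γ => 1 - Φ z γ) = 1 - π.avg x₀ j Φ := by
  unfold avg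
  simp only [expect_sub_distrib, expect_const univ_nonempty]

variable [Fintype M]

/-- Planting layer `i` changes the expectation of a test function by at most the expected loss. -/
lemma avg_sub_avg_succ_le (i : Fin k) {T T' : ℕ} (hT : T ≤ T')
    (hturn : ∀ t, T ≤ t → t < T' → (π.turn t).1 ≠ i)
    (Φ : (Fin (k + 1) → X) → (ℕ → M) → ℝ) (h0 : ∀ z γ, 0 ≤ Φ z γ) (h1 : ∀ z γ, Φ z γ ≤ 1)
    (hΦ : ∀ z, ∀ γ γ' : ℕ → M, (∀ t ≤ T', γ t = γ' t) → Φ z γ = Φ z γ') :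
    π.avg x₀ i.val Φ - π.avg x₀ (i.val + 1) Φ
      ≤ π.avg x₀ i.val fun z γ => π.loss i T (pathCell x₀ z i) γ := by
  unfold avg
  rw [← expect_sub_distrib]
  refine expect_le_expect fun z _ => ?_
  rw [expect_resample i fun ω => Φ z (π.states (inputs x₀ i.val z ω)),
    expect_resample i fun ω => Φ z (π.states (inputs x₀ (i.val + 1) z ω)),
    expect_resample i fun ω => π.loss i T (pathCell x₀ z i) (π.states (inputs x₀ i.val z ω)),
    ← expect_sub_distrib]
  refine expect_le_expect fun ω _ => ?_
  simp only [inputs_update_base x₀ le_rfl, inputs_update_plant]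
  exact π.expect_base_sub_plant_le i _ hT hturn _ (Φ z) (h0 z) (h1 z) (hΦ z)

variable [Nonempty X]

/-- If the layers from `i - 1` on are unplanted, the expected loss at the path is small. -/
lemma avg_loss_le (i : Fin k) {j : ℕ} (hj : j + 1 = i.val) (T : ℕ) {N : ℕ}
    (hN : ((range T).filter fun t => (π.turn t).1 = i).card ≤ N) {θ : ℝ} (hθ : 0 < θ) :
    (π.avg x₀ j fun z γ => π.loss i T (pathCell x₀ z i) γ)
      ≤ θ + 64 * (N * Real.log (Fintype.card M)) / (θ * Fintype.card (X × X)) := by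
  unfold avg
  rw [expect_resample i.succ, expect_resample i.castSucc]
  refine expect_le univ_nonempty fun z _ => ?_
  have hcell : ∀ x y, pathCell x₀ (update (update z i.castSucc x) i.succ y) i = (x, y) := by
    intro x y
    have h0 : i.val ≠ 0 := by omega
    have h1 : i.castSucc ≠ i.succ := Fin.castSucc_lt_succ.ne
    simp [pathCell, h0, h1]
  have hinp : ∀ x y ω, inputs x₀ j (update (update z i.castSucc x) i.succ y) ω
      = inputs x₀ j z ω := by
    intro x y ω
    refine inputs_congr x₀ (fun l hl => ?_) ω
    rw [update_of_ne, update_of_ne]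
    · intro h; rw [h] at hl; simp at hl; omega
    · intro h; rw [h] at hl; simp at hl; omega
  simp only [hcell, hinp]
  have hprod := expect_product' (univ : Finset X) (univ : Finset X) fun x y =>
    𝔼 ω : Seeds k X, π.loss i T (x, y) (π.states (inputs x₀ j z ω))
  rw [← hprod, univ_product_univ, expect_comm]
  rw [expect_resample i fun ω : Seeds k X =>
    𝔼 c : X × X, π.loss i T (c.1, c.2) (π.states (inputs x₀ j z ω))]
  refine expect_le univ_nonempty fun ω _ => ?_
  simp only [inputs_update_base x₀ (show j ≤ i.val by omega)]
  rw [expect_comm]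
  exact π.expect_loss_le i _ T hN hθ

/-- In the first `U i` steps, a test function cannot tell whether layer `i` has been planted.  The
errors add up, because the expected loss in layer `i + 1` is a test function that only involves the
first `U i` steps: by then it can be evaluated with layer `i` unplanted, and then the place of the
planted element of layer `i + 1` is independent of the history. -/
theorem avg_sub_avg_succ_le_mul (U : ℕ → ℕ) (hU0 : ∀ t < U 0, (π.turn t).1.val ≠ 0)
    (hU : ∀ i, i + 1 < k → U i ≤ U (i + 1) ∧
      ∀ t, U i ≤ t → t < U (i + 1) → (π.turn t).1.val ≠ i + 1)
    {N : ℕ} (hN : ∀ (i : Fin k) (j : ℕ), j + 1 = i.val →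
      ((range (U j)).filter fun t => (π.turn t).1 = i).card ≤ N) {θ : ℝ} (hθ : 0 < θ)
    (i : ℕ) (hi : i < k)
    (Φ : (Fin (k + 1) → X) → (ℕ → M) → ℝ) (h0 : ∀ z γ, 0 ≤ Φ z γ) (h1 : ∀ z γ, Φ z γ ≤ 1)
    (hΦ : ∀ z, ∀ γ γ' : ℕ → M, (∀ t ≤ U i, γ t = γ' t) → Φ z γ = Φ z γ') :
    π.avg x₀ i Φ - π.avg x₀ (i + 1) Φ
      ≤ i * (θ + 64 * (N * Real.log (Fintype.card M)) / (θ * Fintype.card (X × X))) := by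
  induction i generalizing Φ with
  | zero =>
    refine (π.avg_sub_avg_succ_le x₀ ⟨0, hi⟩ (Nat.zero_le (U 0))
      (fun t _ ht h => hU0 t ht (by rw [h])) Φ h0 h1 hΦ).trans (le_of_eq ?_)
    have : ∀ c γ, π.loss ⟨0, hi⟩ 0 c γ = 0 := by
      intro c γ
      simp [loss, baseProb, plantProb, accepts]
    simp [avg, this]
  | succ i ih =>
    obtain ⟨hle, hturn⟩ := hU i hi
    have s1 := π.avg_sub_avg_succ_le x₀ ⟨i + 1, hi⟩ hle
      (fun t ht ht' h => hturn t ht ht' (by rw [h])) Φ h0 h1 hΦ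
    have s2 := ih (by omega) (fun z γ => 1 - π.loss ⟨i + 1, hi⟩ (U i) (pathCell x₀ z ⟨i + 1, hi⟩) γ)
      (fun z γ => by linarith [π.loss_le_one ⟨i + 1, hi⟩ (U i) (pathCell x₀ z ⟨i + 1, hi⟩) γ])
      (fun z γ => by linarith [π.loss_nonneg ⟨i + 1, hi⟩ (U i) (pathCell x₀ z ⟨i + 1, hi⟩) γ])
      (fun z γ γ' h => by rw [π.loss_congr _ _ h])
    have s3 := π.avg_loss_le x₀ ⟨i + 1, hi⟩ (j := i) rfl (U i) (hN _ _ rfl) hθ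
    rw [avg_one_sub, avg_one_sub] at s2
    push_cast
    simp only at s1
    linarith

/-- The end of the planted path cannot be guessed from the memory after `U (k - 1)` steps. -/
theorem avg_guess_le (U : ℕ → ℕ) (hU0 : ∀ t < U 0, (π.turn t).1.val ≠ 0)
    (hU : ∀ i, i + 1 < k → U i ≤ U (i + 1) ∧
      ∀ t, U i ≤ t → t < U (i + 1) → (π.turn t).1.val ≠ i + 1)
    {N : ℕ} (hN : ∀ (i : Fin k) (j : ℕ), j + 1 = i.val →
      ((range (U j)).filter fun t => (π.turn t).1 = i).card ≤ N) {θ : ℝ} (hθ : 0 < θ)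
    {p : ℕ} (hp : p + 1 = k) (g : M → X → ℝ) (g0 : ∀ μ x, 0 ≤ g μ x) (g1 : ∀ μ, ∑ x, g μ x ≤ 1) :
    (π.avg x₀ k fun z γ => g (γ (U p)) (z (Fin.last k)))
      ≤ 1 / Fintype.card X
        + p * (θ + 64 * (N * Real.log (Fintype.card M)) / (θ * Fintype.card (X × X))) := by
  have g2 : ∀ μ x, g μ x ≤ 1 := fun μ x =>
    (Finset.single_le_sum (fun x _ => g0 μ x) (Finset.mem_univ x)).trans (g1 μ)
  have s1 := π.avg_sub_avg_succ_le_mul x₀ U hU0 hU hN hθ p (by omega)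
    (fun z γ => 1 - g (γ (U p)) (z (Fin.last k)))
    (fun z γ => by linarith [g2 (γ (U p)) (z (Fin.last k))])
    (fun z γ => by linarith [g0 (γ (U p)) (z (Fin.last k))])
    (fun z γ γ' h => by rw [h _ le_rfl])
  have s2 : (π.avg x₀ p fun z γ => g (γ (U p)) (z (Fin.last k))) ≤ 1 / Fintype.card X := by
    unfold avg
    rw [expect_resample (Fin.last k)]
    refine expect_le univ_nonempty fun z _ => ?_
    have : ∀ x ω, inputs x₀ p (update z (Fin.last k) x) ω = inputs x₀ p z ω := by
      intro x ω
      refine inputs_congr x₀ (fun l hl => ?_) ω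
      rw [update_of_ne]
      intro h; rw [h] at hl; simp at hl; omega
    simp only [this, update_self]
    rw [expect_comm]
    refine expect_le univ_nonempty fun ω _ => ?_
    rw [Fintype.expect_eq_sum_div_card]
    exact div_le_div_of_nonneg_right (g1 _) (Nat.cast_nonneg _)
  rw [avg_one_sub, avg_one_sub, hp] at s1
  linarith

end Protocol

/-! ### The energy of a layered network -/

section Energy

variable {m : ℕ}

/-- Energy of one layer: `s` and `s'` are indicators of the vertices on the source side before and
after the layer. -/
def layerEnergy (g : Fin m → Fin m → ℤ) (s s' : Fin m → ℤ) : ℤ :=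
  ∑ y, s' y * (7 - 2 * ∑ x, g x y * s x)

lemma neg_le_layerEnergy (g : Fin m → Fin m → ℤ) (s s' : Fin m → ℤ)
    (hg : ∀ x y, 0 ≤ g x y ∧ g x y ≤ 4) (hs : ∀ x, s x = 0 ∨ s x = 1)
    (hs' : ∀ x, s' x = 0 ∨ s' x = 1) : -(8 * (m : ℤ) ^ 2) ≤ layerEnergy g s s' := by
  have h1 : ∀ y, ∑ x, g x y * s x ≤ 4 * m := by
    intro y
    calc ∑ x, g x y * s x ≤ ∑ _x : Fin m, (4 : ℤ) := by
          refine Finset.sum_le_sum fun x _ => ?_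
          rcases hs x with h | h <;> rw [h] <;> linarith [(hg x y).2]
      _ = 4 * m := by simp; ring
  calc -(8 * (m : ℤ) ^ 2) = ∑ _y : Fin m, -(8 * (m : ℤ)) := by simp; ring
    _ ≤ layerEnergy g s s' := by
        refine Finset.sum_le_sum fun y _ => ?_
        have := h1 y
        have : (0 : ℤ) ≤ m := Nat.cast_nonneg m
        rcases hs' y with h | h <;> rw [h] <;> linarith

/-- The weights of the layers decrease so fast that each layer dominates all later ones. -/
lemma neg_le_sum_layerEnergy {B : ℤ} (hB : 8 * (m : ℤ) ^ 2 + 1 ≤ B) (k : ℕ)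
    (g : Fin k → Fin m → Fin m → ℤ) (s : Fin (k + 1) → Fin m → ℤ)
    (hg : ∀ i x y, 0 ≤ g i x y ∧ g i x y ≤ 4) (hs : ∀ i x, s i x = 0 ∨ s i x = 1) :
    -(B ^ (k + 1) - B) ≤
      ∑ i : Fin k, B ^ (k - i.val) * layerEnergy (g i) (s i.castSucc) (s i.succ) := by
  have hB0 : 0 ≤ B := by nlinarith [sq_nonneg (m : ℤ)]
  induction k with
  | zero => simp
  | succ k ih =>
    rw [Fin.sum_univ_succ]
    have h1 := ih (fun i => g i.succ) (fun i => s i.succ) (fun i => hg i.succ) (fun i => hs i.succ)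
    have h2 := neg_le_layerEnergy (g 0) (s 0) (s 1) (hg 0) (hs 0) (hs 1)
    have h3 : B ^ (k + 1) * -(8 * (m : ℤ) ^ 2) ≤ B ^ (k + 1) * layerEnergy (g 0) (s 0) (s 1) :=
      mul_le_mul_of_nonneg_left h2 (by positivity)
    have h4 : B ^ (k + 1) * (8 * (m : ℤ) ^ 2 + 1) ≤ B ^ (k + 1) * B :=
      mul_le_mul_of_nonneg_left hB (by positivity)
    have e : ∀ i : Fin k, B ^ (k + 1 - i.succ.val) *
        layerEnergy (g i.succ) (s i.succ.castSucc) (s i.succ.succ) =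
        B ^ (k - i.val) * layerEnergy (g i.succ) (s i.castSucc.succ) (s i.succ.succ) := by
      intro i
      rw [Fin.val_succ, Nat.add_sub_add_right, Fin.succ_castSucc]
    simp only [Fin.val_zero, Nat.sub_zero, Fin.castSucc_zero, Fin.succ_zero_eq_one] at *
    rw [Finset.sum_congr rfl fun i _ => e i]
    rw [pow_succ]
    linarith

/-- Starting from a single vertex `x`, a layer with a unique entry `4` in row `x` has energy `-1` at
the corresponding vertex, and nonnegative energy at all other sets. -/
lemma layerEnergy_nonneg_of_ne (g : Fin m → Fin m → ℤ) (s s' : Fin m → ℤ) (x y : Fin m)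
    (hs : s = Pi.single x 1) (hxy : g x y = 4) (hg : ∀ v, v ≠ y → g x v ≤ 3)
    (hs' : ∀ v, s' v = 0 ∨ s' v = 1) (hne : s' ≠ Pi.single y 1) : 0 ≤ layerEnergy g s s' := by
  have e : layerEnergy g s s' = ∑ v, s' v * (7 - 2 * g x v) := by
    unfold layerEnergy
    refine Finset.sum_congr rfl fun v _ => ?_
    rw [hs]; simp [Pi.single_apply]
  have hn : ∀ v, v ≠ y → s' v ≤ s' v * (7 - 2 * g x v) := by
    intro v hv
    rcases hs' v with h | h <;> rw [h] <;> linarith [hg v hv]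
  have h0 : ∀ v, 0 ≤ s' v := fun v => by rcases hs' v with h | h <;> rw [h]; norm_num
  rw [e, ← Finset.add_sum_erase _ _ (Finset.mem_univ y), hxy]
  have h1 : ∑ v ∈ univ.erase y, s' v ≤ ∑ v ∈ univ.erase y, s' v * (7 - 2 * g x v) :=
    Finset.sum_le_sum fun v hv => hn v (Finset.ne_of_mem_erase hv)
  rcases hs' y with h | h
  · rw [h]
    linarith [Finset.sum_nonneg fun v (_ : v ∈ univ.erase y) => h0 v]
  · have : ∃ v, v ≠ y ∧ s' v = 1 := by
      by_contra hcon
      push Not at hcon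
      apply hne
      funext v
      by_cases hv : v = y
      · subst hv; simp [h]
      · simp [hv, (hs' v).resolve_right (hcon v hv)]
    obtain ⟨v, hv, hv1⟩ := this
    have := Finset.single_le_sum (f := s') (fun v _ => h0 v)
      (Finset.mem_erase.mpr ⟨hv, Finset.mem_univ v⟩)
    rw [h]; linarith

lemma layerEnergy_single (g : Fin m → Fin m → ℤ) (x y : Fin m) (hxy : g x y = 4) :
    layerEnergy g (Pi.single x 1) (Pi.single y 1) = -1 := by
  simp [layerEnergy, Pi.single_apply, hxy]

/-- The minimum energy is attained by the path `ζ`. -/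
lemma le_sum_layerEnergy {B : ℤ} (hB : 8 * (m : ℤ) ^ 2 + 1 ≤ B) (ν : Fin m → ℤ)
    (hν : ∀ y, 0 ≤ ν y ∧ ν y ≤ B) (k : ℕ)
    (g : Fin k → Fin m → Fin m → ℤ) (s : Fin (k + 1) → Fin m → ℤ) (ζ : Fin (k + 1) → Fin m)
    (hg : ∀ i x y, 0 ≤ g i x y ∧ g i x y ≤ 4) (hs : ∀ i x, s i x = 0 ∨ s i x = 1)
    (hs0 : s 0 = Pi.single (ζ 0) 1) (hζ : ∀ i : Fin k, g i (ζ i.castSucc) (ζ i.succ) = 4)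
    (hζ' : ∀ (i : Fin k) y, y ≠ ζ i.succ → g i (ζ i.castSucc) y ≤ 3) :
    -∑ i : Fin k, B ^ (k - i.val) + ν (ζ (Fin.last k)) ≤
      ∑ i : Fin k, B ^ (k - i.val) * layerEnergy (g i) (s i.castSucc) (s i.succ)
        + ∑ y, ν y * s (Fin.last k) y := by
  have hB0 : 0 ≤ B := by nlinarith [sq_nonneg (m : ℤ)]
  induction k with
  | zero =>
    rw [show Fin.last 0 = 0 from rfl, hs0]; simp [Pi.single_apply]
  | succ k ih =>
    have e : ∀ i : Fin k, B ^ (k + 1 - i.succ.val) *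
        layerEnergy (g i.succ) (s i.succ.castSucc) (s i.succ.succ) =
        B ^ (k - i.val) * layerEnergy (g i.succ) (s i.castSucc.succ) (s i.succ.succ) := by
      intro i
      rw [Fin.val_succ, Nat.add_sub_add_right, Fin.succ_castSucc]
    have e' : ∀ i : Fin k, B ^ (k + 1 - i.succ.val) = B ^ (k - i.val) := by
      intro i
      rw [Fin.val_succ, Nat.add_sub_add_right]
    rw [Fin.sum_univ_succ, Fin.sum_univ_succ, Finset.sum_congr rfl fun i _ => e i,
      Finset.sum_congr rfl fun i _ => e' i]
    simp only [Fin.val_zero, Nat.sub_zero, Fin.castSucc_zero, Fin.succ_zero_eq_one]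
    by_cases h1 : s 1 = Pi.single (ζ 1) 1
    · have := ih (fun i => g i.succ) (fun i => s i.succ) (fun i => ζ i.succ) (fun i => hg i.succ)
        (fun i => hs i.succ) h1 (fun i => hζ i.succ) (fun i => hζ' i.succ)
      have h0 : layerEnergy (g 0) (s 0) (s 1) = -1 := by
        rw [hs0, h1]; exact layerEnergy_single _ _ _ (hζ 0)
      rw [h0]
      simp only [Fin.succ_last] at this
      linarith
    · have h0 := layerEnergy_nonneg_of_ne (g 0) (s 0) (s 1) (ζ 0) (ζ 1) hs0 (hζ 0) (hζ' 0) (hs 1) h1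
      have h2 := neg_le_sum_layerEnergy hB k (fun i => g i.succ) (fun i => s i.succ)
        (fun i => hg i.succ) (fun i => hs i.succ)
      have h3 : 0 ≤ ∑ y, ν y * s (Fin.last (k + 1)) y := by
        refine Finset.sum_nonneg fun y _ => mul_nonneg (hν y).1 ?_
        rcases hs (Fin.last (k + 1)) y with h | h <;> rw [h]; norm_num
      have h4 : 0 ≤ ∑ i : Fin k, B ^ (k - i.val) := Finset.sum_nonneg fun i _ => by positivity
      have h5 := (hν (ζ (Fin.last (k + 1)))).2
      have h6 : 0 ≤ B ^ (k + 1) * layerEnergy (g 0) (s 0) (s 1) := mul_nonneg (by positivity) h0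
      linarith

lemma sum_layerEnergy_path {B : ℤ} (ν : Fin m → ℤ) (k : ℕ)
    (g : Fin k → Fin m → Fin m → ℤ) (ζ : Fin (k + 1) → Fin m)
    (hζ : ∀ i : Fin k, g i (ζ i.castSucc) (ζ i.succ) = 4) :
    ∑ i : Fin k, B ^ (k - i.val) *
        layerEnergy (g i) (Pi.single (ζ i.castSucc) 1) (Pi.single (ζ i.succ) 1)
        + ∑ y, ν y * (Pi.single (ζ (Fin.last k)) 1 : Fin m → ℤ) y
      = -∑ i : Fin k, B ^ (k - i.val) + ν (ζ (Fin.last k)) := by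
  simp [layerEnergy_single _ _ _ (hζ _), Pi.single_apply]

end Energy

/-! ### The layered network -/

section Network

/-- The vertices: source and sink, the vertices `core i y` of the `k + 1` levels, and for each
layer `i` and each of its two players a private copy of the level before (`role = false`) and of the
level after (`role = true`) the layer.  The copies keep the edges of different players distinct. -/
abbrev Vtx (k m : ℕ) : Type :=
  Bool ⊕ (Fin (k + 1) × Fin m) ⊕ (Fin k × Bool × Bool × Fin m)

/-- The edges: those of the matrices, those from private copies to the sink, those that tie
private copies to core vertices, those from the source to core vertices, and those that fix the
level `0`. -/
abbrev Edge (k m : ℕ) : Type :=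
  (Fin k × Bool × Fin m × Fin m) ⊕ (Fin k × Bool × Bool × Fin m) ⊕ (Fin k × Bool × Bool × Fin m) ⊕
    (Fin k × Fin m) ⊕ Fin m

variable {k m : ℕ}

/-- The source. -/
def Vtx.src : Vtx k m := .inl false

/-- The sink. -/
def Vtx.snk : Vtx k m := .inl true

/-- The vertex `y` of level `i`. -/
def Vtx.core (i : Fin (k + 1)) (y : Fin m) : Vtx k m := .inr (.inl (i, y))

/-- The private copy of a vertex that player `(i, b)` uses. -/
def Vtx.copy (i : Fin k) (b role : Bool) (y : Fin m) : Vtx k m := .inr (.inr (i, b, role, y))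

/-- The level to which the private copies of layer `i` belong. -/
def level (i : Fin k) (role : Bool) : Fin (k + 1) := if role then i.succ else i.castSucc

/-- The two endpoints of an edge. -/
def ends (x₀ : Fin m) : Edge k m → Vtx k m × Vtx k m
  | .inl (i, b, x, y) => (.copy i b false x, .copy i b true y)
  | .inr (.inl (i, b, r, y)) => (.copy i b r y, .snk)
  | .inr (.inr (.inl (i, b, r, y))) => (.copy i b r y, .core (level i r) y)
  | .inr (.inr (.inr (.inl (i, y)))) => (.src, .core i.succ y)
  | .inr (.inr (.inr (.inr x))) => (.core 0 x, if x = x₀ then .src else .snk)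

/-- The player who knows the weight of an edge; `P₀` is responsible for the edges of level `0`. -/
def owner (P₀ : Fin k × Bool) : Edge k m → Fin k × Bool
  | .inl (i, b, _, _) => (i, b)
  | .inr (.inl (i, b, _, _)) => (i, b)
  | .inr (.inr (.inl (i, b, _, _))) => (i, b)
  | .inr (.inr (.inr (.inl (i, _)))) => (i, true)
  | .inr (.inr (.inr (.inr _))) => P₀

/-- The ratio of the weights of consecutive layers. -/
def ratio (m : ℕ) : ℕ := 8 * m ^ 2 + 1

/-- The weight of layer `i`; it vanishes for `i ≥ k`. -/
def scale (k m i : ℕ) : ℕ := if i < k then ratio m ^ (k - i) else 0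

/-- The weight of the edge from the source to `core i.succ y`.  It balances the edges from the
copies of this vertex to the sink, up to an excess that makes the vertex join the source side if and
only if a planted element leads to it.  In the last level it also encodes `y`. -/
def feedWeight (k m : ℕ) (i : Fin k) (y : Fin m) : ℕ :=
  scale k m i * (4 * m - 5) + scale k m (i + 1) * (4 * m + 2) - if i.val + 1 = k then y.val else 0

/-- The minimum cut value, up to a correction that depends only on the end of the path. -/
def baseCost (k m : ℕ) : ℕ :=
  scale k m 0 * (4 * m + 2) + ∑ i : Fin k, ∑ y : Fin m, feedWeight k m i y

/-- A weight that is too large for an edge of a minimum cut. -/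
def hugeWeight (k m : ℕ) : ℕ := baseCost k m + m

/-- An entry of a player's matrix, with values `1` and `2`. -/
def entry (a : Fin m × Fin m → Bool) (x y : Fin m) : ℕ := 1 + (a (x, y)).toNat

/-- The weight of an edge. -/
def weight (I : Fin k × Bool → Fin m × Fin m → Bool) : Edge k m → ℕ
  | .inl (i, b, x, y) => scale k m i * entry (I (i, b)) x y
  | .inr (.inl (i, b, false, x)) => scale k m i * (2 * m + 1 - ∑ y, entry (I (i, b)) x y)
  | .inr (.inl (i, b, true, y)) => scale k m i * (2 * m + 1 - ∑ x, entry (I (i, b)) x y)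
  | .inr (.inr (.inl _)) => hugeWeight k m
  | .inr (.inr (.inr (.inl (i, y)))) => feedWeight k m i y
  | .inr (.inr (.inr (.inr _))) => hugeWeight k m

lemma weight_congr (P₀ : Fin k × Bool) {I I' : Fin k × Bool → Fin m × Fin m → Bool} {e : Edge k m}
    (h : I (owner P₀ e) = I' (owner P₀ e)) : weight I e = weight I' e := by
  rcases e with ⟨i, b, x, y⟩ | ⟨i, b, r, y⟩ | ⟨i, b, r, y⟩ | ⟨i, y⟩ | x
  · simp only [owner] at h
    simp only [weight, h]
  · simp only [owner] at h
    cases r <;> simp only [weight, h]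
  all_goals rfl

lemma ends_injective (x₀ : Fin m) :
    Injective fun e : Edge k m => s((ends x₀ e).1, (ends x₀ e).2) := by
  intro e e' h
  have hne : ∀ i : Fin k, i.succ ≠ 0 := fun i => Fin.succ_ne_zero i
  have hne' : ∀ i : Fin k, 0 ≠ i.succ := fun i => (Fin.succ_ne_zero i).symm
  rcases e with ⟨i, b, x, y⟩ | ⟨i, b, r, y⟩ | ⟨i, b, r, y⟩ | ⟨i, y⟩ | x <;>
  rcases e' with ⟨i', b', x', y'⟩ | ⟨i', b', r', y'⟩ | ⟨i', b', r', y'⟩ | ⟨i', y'⟩ | x' <;>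
  simp only [ends, Sym2.eq_iff, Vtx.src, Vtx.snk, Vtx.core, Vtx.copy] at h <;>
  (try split_ifs at h) <;> simp_all

lemma ends_ne (x₀ : Fin m) (e : Edge k m) : (ends x₀ e).1 ≠ (ends x₀ e).2 := by
  rcases e with ⟨i, b, x, y⟩ | ⟨i, b, r, y⟩ | ⟨i, b, r, y⟩ | ⟨i, y⟩ | x <;>
  simp only [ends, Vtx.src, Vtx.snk, Vtx.core, Vtx.copy] <;>
  (try split_ifs) <;> simp

lemma sum_entry_le (f : Fin m → Bool) : ∑ y, (1 + (f y).toNat) ≤ 2 * m := by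
  calc ∑ y, (1 + (f y).toNat) ≤ ∑ _y : Fin m, 2 :=
        Finset.sum_le_sum fun y _ => by cases f y <;> simp
    _ = 2 * m := by simp; ring

lemma le_ratio (m : ℕ) : m ≤ ratio m := by
  unfold ratio; nlinarith

lemma ratio_le_scale {i : ℕ} (hi : i < k) : ratio m ≤ scale k m i := by
  rw [scale, if_pos hi]
  exact Nat.le_self_pow (by omega) _

lemma scale_pos {i : ℕ} (hi : i < k) : 0 < scale k m i :=
  lt_of_lt_of_le (Nat.succ_pos _) (ratio_le_scale (m := m) hi)

lemma lt_feed (hm : 2 ≤ m) (i : Fin k) (y : Fin m) :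
    y.val < scale k m i * (4 * m - 5) + scale k m (i + 1) * (4 * m + 2) := by
  have h1 : scale k m i * 1 ≤ scale k m i * (4 * m - 5) := Nat.mul_le_mul_left _ (by omega)
  have h2 := ratio_le_scale (m := m) i.2
  have h3 := le_ratio m
  have := y.2
  omega

lemma feedWeight_pos (hm : 2 ≤ m) (i : Fin k) (y : Fin m) : 0 < feedWeight k m i y := by
  have := lt_feed hm i y
  unfold feedWeight
  split_ifs <;> omega

lemma hugeWeight_pos (hm : 2 ≤ m) : 0 < hugeWeight k m := by
  unfold hugeWeight; omega

lemma weight_pos (hm : 2 ≤ m) (I : Fin k × Bool → Fin m × Fin m → Bool) (e : Edge k m) :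
    0 < weight I e := by
  rcases e with ⟨i, b, x, y⟩ | ⟨i, b, r, y⟩ | ⟨i, b, r, y⟩ | ⟨i, y⟩ | x
  · exact Nat.mul_pos (scale_pos i.2) (by simp [entry])
  · cases r
    · refine Nat.mul_pos (scale_pos i.2) ?_
      have := sum_entry_le fun x => I (i, b) (y, x)
      unfold entry; omega
    · refine Nat.mul_pos (scale_pos i.2) ?_
      have := sum_entry_le fun x => I (i, b) (x, y)
      unfold entry; omega
  · exact hugeWeight_pos hm
  · exact feedWeight_pos hm i y
  · exact hugeWeight_pos hm

lemma scale_le (i : ℕ) : scale k m i ≤ ratio m ^ k := by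
  unfold scale
  split_ifs
  · exact Nat.pow_le_pow_right (Nat.succ_pos _) (Nat.sub_le _ _)
  · exact Nat.zero_le _

lemma weight_le_hugeWeight (I : Fin k × Bool → Fin m × Fin m → Bool) (e : Edge k m) :
    weight I e ≤ hugeWeight k m := by
  have hs : ∀ i : Fin k, scale k m i ≤ scale k m 0 := by
    intro i
    have : 0 < k := i.pos
    refine (scale_le _).trans (le_of_eq ?_)
    rw [scale, if_pos this, Nat.sub_zero]
  have hb : ∀ (i : Fin k) (c : ℕ), c ≤ 4 * m + 2 → scale k m i * c ≤ hugeWeight k m := by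
    intro i c hc
    have := Nat.mul_le_mul (hs i) hc
    unfold hugeWeight baseCost; omega
  rcases e with ⟨i, b, x, y⟩ | ⟨i, b, r, y⟩ | ⟨i, b, r, y⟩ | ⟨i, y⟩ | x
  · refine hb i _ ?_
    have := x.2
    have := Bool.toNat_le (I (i, b) (x, y))
    unfold entry; omega
  · cases r <;> exact hb i _ (by omega)
  · exact le_rfl
  · have h1 := Finset.single_le_sum (f := fun i : Fin k => ∑ y : Fin m, feedWeight k m i y)
      (fun _ _ => Nat.zero_le _) (Finset.mem_univ i)
    have h2 := Finset.single_le_sum (f := fun y : Fin m => feedWeight k m i y)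
      (fun _ _ => Nat.zero_le _) (Finset.mem_univ y)
    change feedWeight k m i y ≤ _
    unfold hugeWeight baseCost; omega
  · exact le_rfl

/-- Whether a cut separates the endpoints of an edge; `σ` is the indicator of the source side. -/
def crosses (x₀ : Fin m) (σ : Vtx k m → Bool) (e : Edge k m) : Prop :=
  σ (ends x₀ e).1 ≠ σ (ends x₀ e).2

instance (x₀ : Fin m) (σ : Vtx k m → Bool) (e : Edge k m) : Decidable (crosses x₀ σ e) :=
  inferInstanceAs (Decidable (_ ≠ _))

/-- The weight of a cut. -/
def cutCost (x₀ : Fin m) (I : Fin k × Bool → Fin m × Fin m → Bool) (σ : Vtx k m → Bool) : ℕ :=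
  ∑ e, if crosses x₀ σ e then weight I e else 0

/-- The indicator of the source side in level `i`. -/
def side (σ : Vtx k m → Bool) (i : Fin (k + 1)) (y : Fin m) : ℤ := (σ (.core i y)).toNat

/-- The sum of the two matrices of a layer. -/
def layerMatrix (I : Fin k × Bool → Fin m × Fin m → Bool) (i : Fin k) (x y : Fin m) : ℤ :=
  entry (I (i, false)) x y + entry (I (i, true)) x y

lemma sum_scale_castSucc (R : Fin (k + 1) → ℤ) :
    ∑ i : Fin k, (scale k m i : ℤ) * R i.castSucc
      = scale k m 0 * R 0 + ∑ i : Fin k, (scale k m (i + 1) : ℤ) * R i.succ := by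
  have h1 := Fin.sum_univ_castSucc fun i : Fin (k + 1) => (scale k m i : ℤ) * R i
  have h2 := Fin.sum_univ_succ fun i : Fin (k + 1) => (scale k m i : ℤ) * R i
  have h3 : scale k m k = 0 := by simp [scale]
  simp only [Fin.val_last, h3, Fin.val_castSucc, Fin.val_succ, Fin.val_zero] at h1 h2
  push_cast at h1
  linarith

/-- For cuts that respect the ties and level `0`, the weight of the cut is a constant plus the
energy. -/
lemma cutCost_eq (hm : 2 ≤ m) (x₀ : Fin m) (I : Fin k × Bool → Fin m × Fin m → Bool)
    (σ : Vtx k m → Bool) (hsrc : σ .src = true) (hsnk : σ .snk = false)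
    (htie : ∀ i b r y, σ (.copy i b r y) = σ (.core (level i r) y))
    (hroot : ∀ x, σ (.core 0 x) = decide (x = x₀)) :
    (cutCost x₀ I σ : ℤ) = baseCost k m
      + (∑ i : Fin k, (scale k m i : ℤ) *
          layerEnergy (layerMatrix I i) (side σ i.castSucc) (side σ i.succ)
        + ∑ i : Fin k, ∑ y : Fin m, (if i.val + 1 = k then (y.val : ℤ) else 0) * side σ i.succ y) := by
  have hmat : ∀ (i : Fin k) (b : Bool) (x y : Fin m),
      (((if crosses x₀ σ (.inl (i, b, x, y)) then weight I (.inl (i, b, x, y)) else 0 : ℕ)) : ℤ)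
        = scale k m i * (entry (I (i, b)) x y * side σ i.castSucc x
          + entry (I (i, b)) x y * side σ i.succ y
          - 2 * (entry (I (i, b)) x y * side σ i.castSucc x * side σ i.succ y)) := by
    intro i b x y
    simp only [crosses, ends, weight, htie, level, side, if_true, Bool.false_eq_true, if_false]
    cases σ (.core i.castSucc x) <;> cases σ (.core i.succ y) <;> simp
    right; ring
  have hrow : ∀ (i : Fin k) (b : Bool) (x : Fin m),
      (((if crosses x₀ σ (.inr (.inl (i, b, false, x))) then weight I (.inr (.inl (i, b, false, x)))
        else 0 : ℕ)) : ℤ)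
        = scale k m i * ((2 * m + 1 - ∑ y, (entry (I (i, b)) x y : ℤ)) * side σ i.castSucc x) := by
    intro i b x
    have h := sum_entry_le fun y => I (i, b) (x, y)
    have h' : ∑ y, entry (I (i, b)) x y ≤ 2 * m + 1 := by unfold entry; omega
    simp only [crosses, ends, weight, htie, level, side, Bool.false_eq_true, if_false, hsnk]
    cases σ (.core i.castSucc x)
    · simp
    · simp [Nat.cast_sub h']
  have hcol : ∀ (i : Fin k) (b : Bool) (y : Fin m),
      (((if crosses x₀ σ (.inr (.inl (i, b, true, y))) then weight I (.inr (.inl (i, b, true, y)))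
        else 0 : ℕ)) : ℤ)
        = scale k m i * ((2 * m + 1 - ∑ x, (entry (I (i, b)) x y : ℤ)) * side σ i.succ y) := by
    intro i b y
    have h := sum_entry_le fun x => I (i, b) (x, y)
    have h' : ∑ x, entry (I (i, b)) x y ≤ 2 * m + 1 := by unfold entry; omega
    simp only [crosses, ends, weight, htie, level, side, if_true, hsnk]
    cases σ (.core i.succ y)
    · simp
    · simp [Nat.cast_sub h']
  have htie' : ∀ (i : Fin k) (b r : Bool) (y : Fin m),
      (((if crosses x₀ σ (.inr (.inr (.inl (i, b, r, y)))) then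
        weight I (.inr (.inr (.inl (i, b, r, y)))) else 0 : ℕ)) : ℤ) = 0 := by
    intro i b r y
    simp [crosses, ends, htie]
  have hfeed : ∀ (i : Fin k) (y : Fin m),
      (((if crosses x₀ σ (.inr (.inr (.inr (.inl (i, y))))) then
        weight I (.inr (.inr (.inr (.inl (i, y))))) else 0 : ℕ)) : ℤ)
        = feedWeight k m i y - feedWeight k m i y * side σ i.succ y := by
    intro i y
    simp only [crosses, ends, weight, side, hsrc]
    cases σ (.core i.succ y) <;> simp
  have hroot' : ∀ x : Fin m,
      (((if crosses x₀ σ (.inr (.inr (.inr (.inr x)))) then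
        weight I (.inr (.inr (.inr (.inr x)))) else 0 : ℕ)) : ℤ) = 0 := by
    intro x
    have : ¬ crosses x₀ σ (.inr (.inr (.inr (.inr x)))) := by
      simp only [crosses, ends, hroot, ne_eq, not_not]
      split_ifs with h
      · simp [h, hsrc]
      · simp [h, hsnk]
    simp [this]
  have hfw : ∀ (i : Fin k) (y : Fin m), (feedWeight k m i y : ℤ)
      = scale k m i * (4 * m - 5) + scale k m (i + 1) * (4 * m + 2)
        - if i.val + 1 = k then (y.val : ℤ) else 0 := by
    intro i y
    have h := lt_feed hm i y
    have h5 : 5 ≤ 4 * m := by omega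
    unfold feedWeight
    split_ifs
    · rw [Nat.cast_sub h.le]; push_cast [Nat.cast_sub h5]; ring
    · rw [Nat.sub_zero]; push_cast [Nat.cast_sub h5]; ring
  -- the part of the cost that belongs to one player: row and column sums cancel
  have hplayer : ∀ (i : Fin k) (b : Bool),
      ∑ x, ∑ y, ((scale k m i : ℤ) * (entry (I (i, b)) x y * side σ i.castSucc x
          + entry (I (i, b)) x y * side σ i.succ y
          - 2 * (entry (I (i, b)) x y * side σ i.castSucc x * side σ i.succ y)))
        + (∑ y, (scale k m i : ℤ) * ((2 * m + 1 - ∑ x, (entry (I (i, b)) x y : ℤ)) * side σ i.succ y)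
        + ∑ x, (scale k m i : ℤ) *
            ((2 * m + 1 - ∑ y, (entry (I (i, b)) x y : ℤ)) * side σ i.castSucc x))
      = (scale k m i : ℤ) * ((2 * m + 1) * ∑ x, side σ i.castSucc x + (2 * m + 1) * ∑ y, side σ i.succ y
          - 2 * ∑ y, ∑ x, entry (I (i, b)) x y * side σ i.castSucc x * side σ i.succ y) := by
    intro i b
    simp only [← Finset.mul_sum, Finset.sum_sub_distrib, Finset.sum_add_distrib, sub_mul,
      Finset.sum_mul]
    rw [Finset.sum_comm (f := fun x y => (entry (I (i, b)) x y : ℤ) * side σ i.succ y),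
      Finset.sum_comm (f := fun x y =>
        (entry (I (i, b)) x y : ℤ) * side σ i.castSucc x * side σ i.succ y)]
    ring
  have hlayer : ∀ i : Fin k, layerEnergy (layerMatrix I i) (side σ i.castSucc) (side σ i.succ)
      = 7 * ∑ y, side σ i.succ y
        - 2 * ∑ y, ∑ x, entry (I (i, false)) x y * side σ i.castSucc x * side σ i.succ y
        - 2 * ∑ y, ∑ x, entry (I (i, true)) x y * side σ i.castSucc x * side σ i.succ y := by
    intro i
    simp only [layerEnergy, layerMatrix]
    rw [Finset.mul_sum, Finset.mul_sum, Finset.mul_sum, ← Finset.sum_sub_distrib,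
      ← Finset.sum_sub_distrib]
    refine Finset.sum_congr rfl fun y _ => ?_
    simp only [add_mul, Finset.sum_add_distrib, ← Finset.sum_mul]
    ring
  have hR0 : ∑ x, side σ 0 x = 1 := by
    simp only [side, hroot]
    rw [Finset.sum_eq_single x₀] <;> simp +contextual
  unfold cutCost
  simp only [Fintype.sum_sum_type, Fintype.sum_prod_type, Fintype.sum_bool]
  simp only [Nat.cast_sum, Nat.cast_add]
  simp only [hmat, hrow, hcol, htie', hfeed, hroot', Finset.sum_const_zero, add_zero, zero_add]
  rw [← add_assoc, ← Finset.sum_add_distrib]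
  have h2 : ∀ i : Fin k, ∑ y, ((feedWeight k m i y : ℤ) - feedWeight k m i y * side σ i.succ y)
      = ∑ y, (feedWeight k m i y : ℤ) - ((4 * m - 5) * ((scale k m i : ℤ) * ∑ x, side σ i.succ x)
        + (4 * m + 2) * ((scale k m (i + 1) : ℤ) * ∑ x, side σ i.succ x))
        + ∑ y : Fin m, (if i.val + 1 = k then (y.val : ℤ) else 0) * side σ i.succ y := by
    intro i
    simp only [Finset.mul_sum]
    rw [← Finset.sum_add_distrib, ← Finset.sum_sub_distrib, ← Finset.sum_add_distrib]
    refine Finset.sum_congr rfl fun y _ => ?_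
    rw [hfw]; ring
  have h3 := sum_scale_castSucc (m := m) fun i => ∑ x, side σ i x
  rw [hR0] at h3
  trans (∑ i : Fin k, ((scale k m i : ℤ) * layerEnergy (layerMatrix I i) (side σ i.castSucc)
      (side σ i.succ) + ((4 * m + 2) * ((scale k m i : ℤ) * ∑ x, side σ i.castSucc x)
        + (4 * m - 5) * ((scale k m i : ℤ) * ∑ x, side σ i.succ x))))
      + ∑ i : Fin k, (∑ y, (feedWeight k m i y : ℤ)
        - ((4 * m - 5) * ((scale k m i : ℤ) * ∑ x, side σ i.succ x)
        + (4 * m + 2) * ((scale k m (i + 1) : ℤ) * ∑ x, side σ i.succ x))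
        + ∑ y : Fin m, (if i.val + 1 = k then (y.val : ℤ) else 0) * side σ i.succ y)
  · refine congrArg₂ (· + ·) (Finset.sum_congr rfl fun i _ => ?_)
      (Finset.sum_congr rfl fun i _ => h2 i)
    linear_combination (hplayer i true) + hplayer i false - (scale k m i : ℤ) * hlayer i
  simp only [Finset.sum_add_distrib, Finset.sum_sub_distrib, ← Finset.mul_sum] at h3 ⊢
  unfold baseCost
  push_cast
  linear_combination (4 * (m : ℤ) + 2) * h3

end Network

section MinCut

variable {k m : ℕ}

/-- The value of a minimum cut in the network of a path that ends at `y`. -/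
def cutValue (k m : ℕ) (y : Fin m) : ℤ := baseCost k m - ∑ i : Fin k, (scale k m i : ℤ) + y.val

lemma cutValue_injective (k m : ℕ) : Injective (cutValue k m) := by
  intro y y' h
  unfold cutValue at h
  exact Fin.ext (by omega)

/-- The matrices of the players describe the path `ζ`: the two matrices of a layer have the sum `4`
at the place that the path picks, and a smaller sum at the other places in the same row. -/
def IsPath (I : Fin k × Bool → Fin m × Fin m → Bool) (ζ : Fin (k + 1) → Fin m) : Prop :=
  ∀ i : Fin k, layerMatrix I i (ζ i.castSucc) (ζ i.succ) = 4 ∧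
    ∀ y, y ≠ ζ i.succ → layerMatrix I i (ζ i.castSucc) y ≤ 3

lemma layerMatrix_bounds (I : Fin k × Bool → Fin m × Fin m → Bool) (i : Fin k) (x y : Fin m) :
    0 ≤ layerMatrix I i x y ∧ layerMatrix I i x y ≤ 4 := by
  unfold layerMatrix entry
  cases I (i, false) (x, y) <;> cases I (i, true) (x, y) <;> simp

lemma side_eq (σ : Vtx k m → Bool) (i : Fin (k + 1)) (y : Fin m) :
    side σ i y = 0 ∨ side σ i y = 1 := by
  unfold side
  cases σ (.core i y) <;> simp

lemma scale_cast (i : Fin k) : (scale k m i : ℤ) = (ratio m : ℤ) ^ (k - i.val) := by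
  simp [scale]

lemma sum_last_level (hk : 0 < k) (f : Fin (k + 1) → Fin m → ℤ) :
    ∑ i : Fin k, ∑ y : Fin m, (if i.val + 1 = k then (y.val : ℤ) else 0) * f i.succ y
      = ∑ y : Fin m, (y.val : ℤ) * f (Fin.last k) y := by
  obtain ⟨k, rfl⟩ := Nat.exists_eq_succ_of_ne_zero hk.ne'
  rw [Finset.sum_eq_single (Fin.last k)]
  · simp
  · intro i _ hi
    have : i.val ≠ k := fun h => hi (Fin.ext h)
    simp [this]
  · simp

lemma cutValue_le_hugeWeight (y : Fin m) : cutValue k m y ≤ hugeWeight k m := by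
  have : 0 ≤ ∑ i : Fin k, (scale k m i : ℤ) := Finset.sum_nonneg fun _ _ => by positivity
  have := y.2
  unfold cutValue hugeWeight
  push_cast
  omega

lemma weight_le_cutCost (x₀ : Fin m) (I : Fin k × Bool → Fin m × Fin m → Bool)
    (σ : Vtx k m → Bool) (e : Edge k m) (h : crosses x₀ σ e) : weight I e ≤ cutCost x₀ I σ := by
  have := Finset.single_le_sum (f := fun e => if crosses x₀ σ e then weight I e else 0)
    (fun _ _ => Nat.zero_le _) (Finset.mem_univ e)
  simp only [if_pos h] at this
  exact this

lemma eight_mul_sq_le_ratio (m : ℕ) : 8 * (m : ℤ) ^ 2 + 1 ≤ ratio m := by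
  unfold ratio; push_cast; exact le_rfl

lemma cutValue_le_cutCost (hk : 0 < k) (hm : 2 ≤ m) {x₀ : Fin m}
    {I : Fin k × Bool → Fin m × Fin m → Bool} {ζ : Fin (k + 1) → Fin m} (hζ : ζ 0 = x₀)
    (hI : IsPath I ζ) (σ : Vtx k m → Bool) (hsrc : σ .src = true) (hsnk : σ .snk = false) :
    cutValue k m (ζ (Fin.last k)) ≤ cutCost x₀ I σ := by
  have huge : ∀ e : Edge k m, weight I e = hugeWeight k m → crosses x₀ σ e →
      cutValue k m (ζ (Fin.last k)) ≤ cutCost x₀ I σ := by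
    intro e he hc
    refine (cutValue_le_hugeWeight _).trans ?_
    rw [← he]
    exact_mod_cast weight_le_cutCost x₀ I σ e hc
  by_cases htie : ∀ i b r y, σ (.copy i b r y) = σ (.core (level i r) y)
  · by_cases hroot : ∀ x, σ (.core 0 x) = decide (x = x₀)
    · rw [cutCost_eq hm x₀ I σ hsrc hsnk htie hroot, sum_last_level hk]
      have := le_sum_layerEnergy (eight_mul_sq_le_ratio m) (fun y : Fin m => (y.val : ℤ))
        (fun y => ⟨by positivity, by exact_mod_cast (y.2.le.trans (le_ratio m))⟩) k
        (layerMatrix I) (side σ) ζ (layerMatrix_bounds I) (side_eq σ)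
        (by
          funext x
          rw [hζ]
          simp only [side, hroot, Pi.single_apply]
          by_cases hx : x = x₀ <;> simp [hx])
        (fun i => (hI i).1) (fun i => (hI i).2)
      simp only [scale_cast, cutValue]
      linarith
    · push Not at hroot
      obtain ⟨x, hx⟩ := hroot
      refine huge (.inr (.inr (.inr (.inr x)))) rfl ?_
      simp only [crosses, ends]
      by_cases h : x = x₀
      · simpa [h, hsrc] using hx
      · simpa [h, hsnk] using hx
  · push Not at htie
    obtain ⟨i, b, r, y, h⟩ := htie
    exact huge (.inr (.inr (.inl (i, b, r, y)))) rfl h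

/-- The source side that consists of the vertices of the path. -/
def pathSide (ζ : Fin (k + 1) → Fin m) : Vtx k m → Bool
  | .inl b => !b
  | .inr (.inl (i, y)) => decide (y = ζ i)
  | .inr (.inr (i, _, r, y)) => decide (y = ζ (level i r))

lemma cutCost_pathSide (hk : 0 < k) (hm : 2 ≤ m) {x₀ : Fin m}
    {I : Fin k × Bool → Fin m × Fin m → Bool} {ζ : Fin (k + 1) → Fin m} (hζ : ζ 0 = x₀)
    (hI : IsPath I ζ) :
    (cutCost x₀ I (pathSide ζ) : ℤ) = cutValue k m (ζ (Fin.last k)) := by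
  have hs : ∀ i, side (pathSide ζ) i = Pi.single (ζ i) 1 := by
    intro i
    funext y
    simp only [side, Vtx.core, pathSide, Pi.single_apply]
    by_cases h : y = ζ i <;> simp [h]
  rw [cutCost_eq hm x₀ I _ rfl rfl (fun _ _ _ _ => rfl) (fun x => by rw [← hζ]; rfl),
    sum_last_level hk]
  simp only [hs, scale_cast, cutValue]
  rw [sum_layerEnergy_path (fun y : Fin m => (y.val : ℤ)) k (layerMatrix I) ζ fun i => (hI i).1]
  ring

/-! ### The network as a graph on `Fin n` -/

variable {n : ℕ}

/-- The network as a weighted graph on `Fin n`, where `ι` places its vertices. -/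
def netWeight (ι : Vtx k m → Fin n) (x₀ : Fin m) (I : Fin k × Bool → Fin m × Fin m → Bool)
    (e : Sym2 (Fin n)) : ℕ :=
  ∑ f : Edge k m, if s(ι (ends x₀ f).1, ι (ends x₀ f).2) = e then weight I f else 0

lemma edge_injective {ι : Vtx k m → Fin n} (hι : Injective ι) (x₀ : Fin m) :
    Injective fun f : Edge k m => s(ι (ends x₀ f).1, ι (ends x₀ f).2) := by
  intro f f' h
  apply ends_injective x₀
  have : Sym2.map ι s((ends x₀ f).1, (ends x₀ f).2)
      = Sym2.map ι s((ends x₀ f').1, (ends x₀ f').2) := h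
  exact Sym2.map.injective hι this

lemma netWeight_edge {ι : Vtx k m → Fin n} (hι : Injective ι) (x₀ : Fin m)
    (I : Fin k × Bool → Fin m × Fin m → Bool) (f : Edge k m) :
    netWeight ι x₀ I s(ι (ends x₀ f).1, ι (ends x₀ f).2) = weight I f := by
  unfold netWeight
  rw [Finset.sum_eq_single f]
  · simp
  · intro f' _ hne
    rw [if_neg]
    exact fun h => hne (edge_injective hι x₀ h)
  · simp

lemma netWeight_eq_zero {ι : Vtx k m → Fin n} {x₀ : Fin m}
    (I : Fin k × Bool → Fin m × Fin m → Bool) {e : Sym2 (Fin n)}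
    (h : ∀ f : Edge k m, s(ι (ends x₀ f).1, ι (ends x₀ f).2) ≠ e) : netWeight ι x₀ I e = 0 :=
  Finset.sum_eq_zero fun f _ => if_neg (h f)

lemma netWeight_admissible {ι : Vtx k m → Fin n} (hι : Injective ι) (x₀ : Fin m)
    (I : Fin k × Bool → Fin m × Fin m → Bool) {W : ℕ} (hW : hugeWeight k m ≤ W) :
    AdmissibleUndirected W (netWeight ι x₀ I) := by
  refine ⟨fun v => netWeight_eq_zero I fun f h => ?_, fun e => ?_⟩
  · rw [Sym2.eq_iff] at h
    apply ends_ne x₀ f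
    apply hι
    rcases h with ⟨h1, h2⟩ | ⟨h1, h2⟩ <;> rw [h1, h2]
  · by_cases h : ∃ f : Edge k m, s(ι (ends x₀ f).1, ι (ends x₀ f).2) = e
    · obtain ⟨f, rfl⟩ := h
      rw [netWeight_edge hι]
      exact (weight_le_hugeWeight I f).trans hW
    · push Not at h
      rw [netWeight_eq_zero I h]
      exact Nat.zero_le _

lemma sum_cut_edge {V : Type} [Fintype V] [DecidableEq V] (A : Finset V) (a b : V) (c : ℕ) :
    ∑ u ∈ A, ∑ v ∈ Aᶜ, (if s(a, b) = s(u, v) then c else 0)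
      = if decide (a ∈ A) ≠ decide (b ∈ A) then c else 0 := by
  have h1 : ∀ u ∈ A, ∀ v ∈ Aᶜ, s(a, b) = s(u, v) →
      (a ∈ A ∧ b ∉ A ∧ u = a ∧ v = b) ∨ (b ∈ A ∧ a ∉ A ∧ u = b ∧ v = a) := by
    intro u hu v hv h
    rw [Finset.mem_compl] at hv
    rw [Sym2.eq_iff] at h
    rcases h with ⟨rfl, rfl⟩ | ⟨rfl, rfl⟩
    · exact .inl ⟨hu, hv, rfl, rfl⟩
    · exact .inr ⟨hu, hv, rfl, rfl⟩
  by_cases ha : a ∈ A <;> by_cases hb : b ∈ A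
  · rw [Finset.sum_eq_zero]
    · simp [ha, hb]
    · intro u hu
      refine Finset.sum_eq_zero fun v hv => if_neg fun h => ?_
      have := h1 u hu v hv h; tauto
  · rw [Finset.sum_eq_single_of_mem a ha, Finset.sum_eq_single_of_mem b (by simpa using hb)]
    · simp [ha, hb]
    · intro v hv hne
      refine if_neg fun h => ?_
      have := h1 a ha v hv h; tauto
    · intro u hu hne
      refine Finset.sum_eq_zero fun v hv => if_neg fun h => ?_
      have := h1 u hu v hv h; tauto
  · rw [Finset.sum_eq_single_of_mem b hb, Finset.sum_eq_single_of_mem a (by simpa using ha)]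
    · simp [ha, hb, Sym2.eq_swap]
    · intro v hv hne
      refine if_neg fun h => ?_
      have := h1 b hb v hv h; tauto
    · intro u hu hne
      refine Finset.sum_eq_zero fun v hv => if_neg fun h => ?_
      have := h1 u hu v hv h; tauto
  · rw [Finset.sum_eq_zero]
    · simp [ha, hb]
    · intro u hu
      refine Finset.sum_eq_zero fun v hv => if_neg fun h => ?_
      have := h1 u hu v hv h; tauto

lemma sum_netWeight (ι : Vtx k m → Fin n) (x₀ : Fin m)
    (I : Fin k × Bool → Fin m × Fin m → Bool) (A : Finset (Fin n)) :
    ∑ u ∈ A, ∑ v ∈ Aᶜ, netWeight ι x₀ I s(u, v)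
      = cutCost x₀ I fun v => decide (ι v ∈ A) := by
  unfold netWeight cutCost
  have : ∀ u ∈ A, ∑ v ∈ Aᶜ, ∑ f : Edge k m,
      (if s(ι (ends x₀ f).1, ι (ends x₀ f).2) = s(u, v) then weight I f else 0)
      = ∑ f : Edge k m, ∑ v ∈ Aᶜ,
      (if s(ι (ends x₀ f).1, ι (ends x₀ f).2) = s(u, v) then weight I f else 0) :=
    fun u _ => Finset.sum_comm
  rw [Finset.sum_congr rfl this, Finset.sum_comm]
  refine Finset.sum_congr rfl fun f _ => ?_
  rw [sum_cut_edge]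
  rfl

/-- The minimum cut value of the network reveals the end of the path. -/
theorem isMinCut_netWeight (hk : 0 < k) (hm : 2 ≤ m) {x₀ : Fin m}
    {I : Fin k × Bool → Fin m × Fin m → Bool} {ζ : Fin (k + 1) → Fin m} (hζ : ζ 0 = x₀)
    (hI : IsPath I ζ) {ι : Vtx k m → Fin n} (hι : Injective ι) :
    IsMinCutUndirected (ι .src) (ι .snk) (netWeight ι x₀ I)
      ((cutValue k m (ζ (Fin.last k)) : ℤ) : ℝ) := by
  have hreal : ∀ A : Finset (Fin n), ∑ u ∈ A, ∑ v ∈ Aᶜ, (netWeight ι x₀ I s(u, v) : ℝ)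
      = (((cutCost x₀ I fun v => decide (ι v ∈ A) : ℕ) : ℤ) : ℝ) := by
    intro A
    rw [← sum_netWeight]
    push_cast
    rfl
  constructor
  · refine ⟨univ.filter fun v => ∃ q, ι q = v ∧ pathSide ζ q = true, ?_, ?_, ?_⟩
    · simp only [Finset.mem_filter, Finset.mem_univ, true_and]
      exact ⟨_, rfl, rfl⟩
    · simp only [Finset.mem_filter, Finset.mem_univ, true_and]
      rintro ⟨q, hq, h⟩
      rw [hι hq] at h
      exact Bool.noConfusion h
    · rw [hreal, ← cutCost_pathSide hk hm hζ hI]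
      have : (fun v => decide (ι v ∈ univ.filter fun v => ∃ q, ι q = v ∧ pathSide ζ q = true))
          = pathSide ζ := by
        funext v
        simp only [Finset.mem_filter, Finset.mem_univ, true_and, hι.eq_iff]
        simp
      rw [this]
  · rintro y ⟨A, hs, ht, rfl⟩
    rw [hreal]
    exact_mod_cast cutValue_le_cutCost hk hm hζ hI _ (by simpa using hs) (by simpa using ht)

end MinCut

/-! ### Streaming algorithms on the network are protocols -/

section Stream

variable {k m : ℕ}

/-- The vertices of the planted path. -/
def pathVertex (x₀ : Fin m) (z : Fin (k + 1) → Fin m) (i : Fin (k + 1)) : Fin m :=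
  if i.val = 0 then x₀ else z i

lemma pathCell_eq (x₀ : Fin m) (z : Fin (k + 1) → Fin m) (i : Fin k) :
    Protocol.pathCell x₀ z i = (pathVertex x₀ z i.castSucc, pathVertex x₀ z i.succ) := by
  simp [Protocol.pathCell, pathVertex]

lemma basePair_disjoint {Q : Type*} (ω : (Q → Bool) × (Q → Bool) × (Q → Bool)) (c : Q) :
    (basePair ω).1 c = false ∨ (basePair ω).2 c = false := by
  cases h : ω.1 c
  · left; simp [basePair, mask, h]
  · right; simp [basePair, mask, h]

lemma isPath_inputs (x₀ : Fin m) (z : Fin (k + 1) → Fin m) (ω : Protocol.Seeds k (Fin m)) :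
    IsPath (Protocol.inputs x₀ k z ω) (pathVertex x₀ z) := by
  intro i
  have h0 : ∀ b, Protocol.inputs x₀ k z ω (i, b)
      = if b then (plant (pathVertex x₀ z i.castSucc, pathVertex x₀ z i.succ) (basePair (ω i))).2
        else (plant (pathVertex x₀ z i.castSucc, pathVertex x₀ z i.succ) (basePair (ω i))).1 := by
    intro b
    simp only [Protocol.inputs, i.2, if_true, pathCell_eq]
  constructor
  · simp [layerMatrix, entry, h0, plant]
  · intro y hy
    have hne : (pathVertex x₀ z i.castSucc, y) ≠
        (pathVertex x₀ z i.castSucc, pathVertex x₀ z i.succ) := by simp [hy]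
    simp only [layerMatrix, entry, h0, plant, if_true, Bool.false_eq_true, if_false,
      update_of_ne hne]
    rcases basePair_disjoint (ω i) (pathVertex x₀ z i.castSucc, y) with h | h <;> rw [h]
    · cases (basePair (ω i)).2 (pathVertex x₀ z i.castSucc, y) <;> simp
    · cases (basePair (ω i)).1 (pathVertex x₀ z i.castSucc, y) <;> simp

/-- The player whose edges are read in step `t`, when the layers are read from the last to the
first one in each pass. -/
def playerAt (k : ℕ) (hk : 0 < k) (t : ℕ) : Fin k × Bool :=
  (⟨k - 1 - t % (2 * k) / 2, by omega⟩, decide (t % 2 = 1))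

variable {n : ℕ}

/-- The edges of a player. -/
noncomputable def playerEdges (P₀ P : Fin k × Bool) : List (Edge k m) :=
  (univ.filter fun f : Edge k m => owner P₀ f = P).toList

/-- The part of the stream that belongs to a player. -/
noncomputable def playerStream (ι : Vtx k m → Fin n) (x₀ : Fin m) (P₀ P : Fin k × Bool)
    (I : Fin k × Bool → Fin m × Fin m → Bool) : List (Sym2 (Fin n) × ℕ) :=
  (playerEdges P₀ P).map fun f => (s(ι (ends x₀ f).1, ι (ends x₀ f).2), weight I f)

/-- The stream of the network. -/
noncomputable def netStream (hk : 0 < k) (ι : Vtx k m → Fin n) (x₀ : Fin m) (P₀ : Fin k × Bool)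
    (I : Fin k × Bool → Fin m × Fin m → Bool) : List (Sym2 (Fin n) × ℕ) :=
  (List.range (2 * k)).flatMap fun t => playerStream ι x₀ P₀ (playerAt k hk t) I

lemma playerAt_injOn (hk : 0 < k) {t t' : ℕ} (ht : t < 2 * k) (ht' : t' < 2 * k)
    (h : playerAt k hk t = playerAt k hk t') : t = t' := by
  unfold playerAt at h
  simp only [Prod.mk.injEq, Fin.mk.injEq, decide_eq_decide, Nat.mod_eq_of_lt ht,
    Nat.mod_eq_of_lt ht'] at h
  omega

lemma exists_playerAt (hk : 0 < k) (P : Fin k × Bool) : ∃ t < 2 * k, playerAt k hk t = P := by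
  obtain ⟨i, b⟩ := P
  refine ⟨2 * (k - 1 - i) + b.toNat, ?_, ?_⟩
  · have := Bool.toNat_le b
    omega
  · have hb := Bool.toNat_le b
    have hi := i.2
    refine Prod.ext (Fin.ext ?_) ?_
    · simp only [playerAt]
      rw [Nat.mod_eq_of_lt (by omega)]; omega
    · cases b <;> simp [playerAt]

lemma mem_playerStream {ι : Vtx k m → Fin n} {x₀ : Fin m} {P₀ P : Fin k × Bool}
    {I : Fin k × Bool → Fin m × Fin m → Bool} {q : Sym2 (Fin n) × ℕ} :
    q ∈ playerStream ι x₀ P₀ P I ↔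
      ∃ f, owner P₀ f = P ∧ (s(ι (ends x₀ f).1, ι (ends x₀ f).2), weight I f) = q := by
  simp [playerStream, playerEdges]

lemma isEdgeStream_netStream (hk : 0 < k) (hm : 2 ≤ m) {ι : Vtx k m → Fin n} (hι : Injective ι)
    (x₀ : Fin m) (P₀ : Fin k × Bool) (I : Fin k × Bool → Fin m × Fin m → Bool) :
    IsEdgeStream (netWeight ι x₀ I) (netStream hk ι x₀ P₀ I) := by
  constructor
  · unfold netStream
    rw [List.nodup_flatMap]
    constructor
    · intro t _
      refine List.Nodup.map ?_ (Finset.nodup_toList _)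
      intro f f' h
      exact edge_injective hι x₀ (Prod.ext_iff.mp h).1
    · refine List.Pairwise.imp_of_mem ?_ (List.nodup_range (n := 2 * k))
      intro t t' ht ht' hne q hq hq'
      rw [List.mem_range] at ht ht'
      rw [mem_playerStream] at hq hq'
      obtain ⟨f, hf, rfl⟩ := hq
      obtain ⟨f', hf', h⟩ := hq'
      have : f' = f := edge_injective hι x₀ (Prod.ext_iff.mp h).1
      subst this
      exact hne (playerAt_injOn hk ht ht' (hf.symm.trans hf'))
  · intro e x
    simp only [netStream, List.mem_flatMap, List.mem_range, mem_playerStream]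
    constructor
    · rintro ⟨t, _, f, _, h⟩
      obtain ⟨rfl, rfl⟩ := Prod.ext_iff.mp h
      exact ⟨netWeight_edge hι x₀ I f, weight_pos hm I f⟩
    · rintro ⟨rfl, hx⟩
      have : ∃ f : Edge k m, s(ι (ends x₀ f).1, ι (ends x₀ f).2) = e := by
        by_contra h
        push Not at h
        rw [netWeight_eq_zero I h] at hx
        exact lt_irrefl _ hx
      obtain ⟨f, rfl⟩ := this
      obtain ⟨t, ht, htf⟩ := exists_playerAt hk (owner P₀ f)
      exact ⟨t, ht, f, htf.symm, by rw [netWeight_edge hι]⟩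

/-- Effect of reading a part of the stream that starts at position `o`. -/
def readFrom {α : Type} {p S : ℕ} (A : StreamAlg α p S) (i : Fin p) (o : ℕ) (σ : List α)
    (μ : Fin S → Bool) : Fin S → Bool :=
  (σ.zipIdx o).foldl (fun μ x => A.step i x.2 x.1 μ) μ

lemma readFrom_append {α : Type} {p S : ℕ} (A : StreamAlg α p S) (i : Fin p) (o : ℕ)
    (σ τ : List α) (μ : Fin S → Bool) :
    readFrom A i o (σ ++ τ) μ = readFrom A i (o + σ.length) τ (readFrom A i o σ μ) := by
  simp [readFrom, List.zipIdx_append, List.foldl_append]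

lemma length_playerStream (ι : Vtx k m → Fin n) (x₀ : Fin m) (P₀ P : Fin k × Bool)
    (I : Fin k × Bool → Fin m × Fin m → Bool) :
    (playerStream ι x₀ P₀ P I).length = (playerEdges (m := m) P₀ P).length := by
  simp [playerStream]

/-- The position in the stream at which the edges of the `t`-th player start.  It does not depend on
the sets of the players. -/
noncomputable def startPos (k m : ℕ) (hk : 0 < k) (P₀ : Fin k × Bool) (t : ℕ) : ℕ :=
  ∑ j ∈ Finset.range t, (playerEdges (m := m) P₀ (playerAt k hk j)).length

/-- The protocol in which each player runs a streaming algorithm on the own edges. -/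
noncomputable def streamProtocol (hk : 0 < k) (ι : Vtx k m → Fin n) (x₀ : Fin m)
    (P₀ : Fin k × Bool) {p S : ℕ} (hp : 0 < p) (A : StreamAlg (Sym2 (Fin n) × ℕ) p S) :
    Protocol k (Fin m × Fin m) (Fin S → Bool) where
  init := A.init
  turn := playerAt k hk
  next t a μ := readFrom A ⟨t / (2 * k) % p, Nat.mod_lt _ hp⟩ (startPos k m hk P₀ (t % (2 * k)))
    (playerStream ι x₀ P₀ (playerAt k hk t) fun _ => a) μ

lemma playerStream_congr (ι : Vtx k m → Fin n) (x₀ : Fin m) (P₀ P : Fin k × Bool)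
    {I I' : Fin k × Bool → Fin m × Fin m → Bool} (h : I P = I' P) :
    playerStream ι x₀ P₀ P I = playerStream ι x₀ P₀ P I' := by
  unfold playerStream
  refine List.map_congr_left fun f hf => ?_
  simp only [playerEdges, Finset.mem_toList, Finset.mem_filter, Finset.mem_univ, true_and] at hf
  subst hf
  rw [weight_congr P₀ h]

lemma playerAt_add (hk : 0 < k) (i t : ℕ) : playerAt k hk (2 * k * i + t) = playerAt k hk t := by
  unfold playerAt
  have h1 : (2 * k * i + t) % (2 * k) = t % (2 * k) := by rw [Nat.mul_add_mod]
  have h2 : (2 * k * i + t) % 2 = t % 2 := by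
    rw [mul_assoc, Nat.mul_add_mod]
  simp only [h1, h2]

lemma states_streamProtocol_pass (hk : 0 < k) (ι : Vtx k m → Fin n) (x₀ : Fin m)
    (P₀ : Fin k × Bool) {p S : ℕ} (hp : 0 < p) (A : StreamAlg (Sym2 (Fin n) × ℕ) p S)
    (I : Fin k × Bool → Fin m × Fin m → Bool) (i : Fin p) (t : ℕ) (ht : t ≤ 2 * k) :
    (streamProtocol hk ι x₀ P₀ hp A).states I (2 * k * i + t)
      = readFrom A i 0 ((List.range t).flatMap fun t => playerStream ι x₀ P₀ (playerAt k hk t) I)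
        ((streamProtocol hk ι x₀ P₀ hp A).states I (2 * k * i)) := by
  induction t with
  | zero => simp [readFrom]
  | succ t ih =>
    have hlen : ((List.range t).flatMap fun t =>
        playerStream ι x₀ P₀ (playerAt k hk t) I).length = startPos k m hk P₀ t := by
      clear ih ht
      induction t with
      | zero => simp [startPos]
      | succ t ih =>
        rw [List.range_succ, List.flatMap_append, List.length_append, ih]
        simp [startPos, Finset.sum_range_succ, length_playerStream]
    rw [List.range_succ, List.flatMap_append, readFrom_append, ← ih (by omega), hlen,
      ← add_assoc, Protocol.states]
    have h1 : (2 * k * i.val + t) / (2 * k) = i.val := by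
      rw [Nat.mul_add_div (by omega), Nat.div_eq_of_lt (by omega), add_zero]
    have h2 : (2 * k * i.val + t) % (2 * k) = t := by
      rw [Nat.mul_add_mod, Nat.mod_eq_of_lt (by omega)]
    simp only [streamProtocol, h1, h2, playerAt_add, Nat.mod_eq_of_lt i.2, zero_add,
      List.flatMap_cons, List.flatMap_nil, List.append_nil]
    rw [playerStream_congr ι x₀ P₀ (playerAt k hk t)
      (I := fun _ => I (playerAt k hk t)) (I' := I) rfl]

lemma states_streamProtocol (hk : 0 < k) (ι : Vtx k m → Fin n) (x₀ : Fin m)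
    (P₀ : Fin k × Bool) {p S : ℕ} (hp : 0 < p) (A : StreamAlg (Sym2 (Fin n) × ℕ) p S)
    (I : Fin k × Bool → Fin m × Fin m → Bool) :
    (streamProtocol hk ι x₀ P₀ hp A).states I (2 * k * p)
      = A.finalMemory (netStream hk ι x₀ P₀ I) := by
  have key : ∀ j ≤ p, (streamProtocol hk ι x₀ P₀ hp A).states I (2 * k * j)
      = ((List.finRange p).take j).foldl
        (fun μ i => A.runPass i (netStream hk ι x₀ P₀ I) μ) A.init := by
    intro j
    induction j with
    | zero => intro _; rfl
    | succ j ih =>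
      intro hj
      have h := states_streamProtocol_pass hk ι x₀ P₀ hp A I ⟨j, hj⟩ (2 * k) le_rfl
      rw [List.take_add_one, List.foldl_append, ← ih (by omega), mul_add, mul_one]
      simp only at h
      rw [h]
      have : (List.finRange p)[j]? = some ⟨j, hj⟩ := by
        rw [List.getElem?_eq_getElem (by simpa using hj)]
        simp
      rw [this]
      rfl
  rw [key p le_rfl, List.take_of_length_le (by simp)]
  rfl

end Stream

/-! ### Maximum flows and minimum cuts -/

section Flow

variable {V : Type} [Fintype V]

/-- The net amount that leaves the vertex `x`. -/
def divergence (f : V → V → ℝ) (x : V) : ℝ := ∑ y, f x y - ∑ y, f y x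

/-- The flow `f` respects the capacities, but need not be conserved anywhere. -/
def RespectsCapacity (w : V × V → ℕ) (f : V → V → ℝ) : Prop :=
  (∀ u v, 0 ≤ f u v) ∧ ∀ u v, f u v ≤ w (u, v)

lemma divergence_combination (f g : V → V → ℝ) (a b : ℝ) (x : V) :
    divergence (fun u v => a * f u v + b * g u v) x = a * divergence f x + b * divergence g x := by
  simp only [divergence, Finset.sum_add_distrib, ← Finset.mul_sum]
  ring

/-- An undirected graph has the same maximum flows as the directed graph in which each edge is
replaced by two opposite ones: opposite flows cancel. -/
lemma IsMaxFlowUndirected.isMaxFlowDirected {s t : V} {w : Sym2 V → ℕ} {x : ℝ}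
    (h : IsMaxFlowUndirected s t w x) :
    IsMaxFlowDirected s t (fun e : V × V => w s(e.1, e.2)) x := by
  obtain ⟨⟨f, hf, hw, rfl⟩, hmax⟩ := h
  constructor
  · exact ⟨f, hf, fun u v => by have := hw u v; have := hf.1 v u; simp only; linarith, rfl⟩
  · rintro y ⟨g, hg, hgw, rfl⟩
    have hdiff : ∀ u v, max (g u v - g v u) 0 - max (g v u - g u v) 0 = g u v - g v u := by
      intro u v
      rcases le_total (g u v) (g v u) with h | h
      · rw [max_eq_right (by linarith), max_eq_left (by linarith)]; ring
      · rw [max_eq_left (by linarith), max_eq_right (by linarith)]; ring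
    have hdiv : ∀ v, divergence (fun a b => max (g a b - g b a) 0) v = divergence g v := by
      intro v
      unfold divergence
      rw [← Finset.sum_sub_distrib, ← Finset.sum_sub_distrib]
      exact Finset.sum_congr rfl fun u _ => hdiff v u
    refine hmax ⟨fun a b => max (g a b - g b a) 0, ⟨fun _ _ => le_max_right _ _, ?_⟩, ?_, ?_⟩
    · intro v hvs hvt
      have h1 := hdiv v
      have h2 := hg.2 v hvs hvt
      unfold divergence at h1
      linarith
    · intro u v
      have h1 := hgw u v
      have h2 := hgw v u
      simp only [Sym2.eq_swap (a := v) (b := u)] at h1 h2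
      have := hg.1 u v
      have := hg.1 v u
      dsimp only
      rcases le_total (g u v) (g v u) with h | h
      · rw [max_eq_right (by linarith), max_eq_left (by linarith)]; linarith
      · rw [max_eq_left (by linarith), max_eq_right (by linarith)]; linarith
    · exact (hdiv s).symm

variable [DecidableEq V]

lemma flowValue_eq_cut {s t : V} {f : V → V → ℝ} (hf : IsConserved s t f) (A : Finset V)
    (hs : s ∈ A) (ht : t ∉ A) :
    flowValue s f = ∑ u ∈ A, ∑ v ∈ Aᶜ, f u v - ∑ u ∈ A, ∑ v ∈ Aᶜ, f v u := by
  have h1 : ∑ u ∈ A, divergence f u = flowValue s f := by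
    rw [Finset.sum_eq_single_of_mem s hs]
    · rfl
    · intro u hu hne
      have hut : u ≠ t := fun h => ht (h ▸ hu)
      unfold divergence
      rw [hf.2 u hne hut, sub_self]
  have h2 : ∀ g : V → ℝ, ∑ y, g y = ∑ y ∈ A, g y + ∑ y ∈ Aᶜ, g y := fun g =>
    (Finset.sum_add_sum_compl A g).symm
  rw [← h1]
  simp only [divergence]
  rw [Finset.sum_sub_distrib]
  simp_rw [h2]
  rw [Finset.sum_add_distrib, Finset.sum_add_distrib, Finset.sum_comm (s := A) (t := A)]
  ring

lemma flowValue_le_cut {s t : V} {w : V × V → ℕ} {f : V → V → ℝ} (hf : IsConserved s t f)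
    (hw : ∀ u v, f u v ≤ w (u, v)) (A : Finset V) (hs : s ∈ A) (ht : t ∉ A) :
    flowValue s f ≤ ∑ u ∈ A, ∑ v ∈ Aᶜ, (w (u, v) : ℝ) := by
  rw [flowValue_eq_cut hf A hs ht]
  have h1 : ∑ u ∈ A, ∑ v ∈ Aᶜ, f u v ≤ ∑ u ∈ A, ∑ v ∈ Aᶜ, (w (u, v) : ℝ) :=
    Finset.sum_le_sum fun u _ => Finset.sum_le_sum fun v _ => hw u v
  have h2 : 0 ≤ ∑ u ∈ A, ∑ v ∈ Aᶜ, f v u :=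
    Finset.sum_nonneg fun u _ => Finset.sum_nonneg fun v _ => hf.1 v u
  linarith

/-- Some residual capacity leads from `u` to `v`. -/
def Residual (w : V × V → ℕ) (f : V → V → ℝ) (u v : V) : Prop := f u v < w (u, v) ∨ 0 < f v u

lemma divergence_single (u v : V) (c : ℝ) (x : V) :
    divergence (fun a b => if a = u ∧ b = v then c else 0) x
      = c * ((if x = u then 1 else 0) - if x = v then 1 else 0) := by
  have h1 : ∑ y, (if x = u ∧ y = v then c else 0) = if x = u then c else 0 := by
    by_cases h : x = u <;> simp [h]
  have h2 : ∑ y, (if y = u ∧ x = v then c else 0) = if x = v then c else 0 := by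
    by_cases h : x = v <;> simp [h]
  unfold divergence
  rw [h1, h2]
  split_ifs <;> ring

/-- A residual edge allows to send a little more along this edge. -/
lemma exists_push {w : V × V → ℕ} {f : V → V → ℝ} (hf : RespectsCapacity w f) {u v : V}
    (h : Residual w f u v) : ∃ g, RespectsCapacity w g ∧ ∃ ε : ℝ, 0 < ε ∧ ∀ x,
      divergence g x = divergence f x + ε * ((if x = u then 1 else 0) - if x = v then 1 else 0) := by
  rcases h with h | h
  · refine ⟨fun a b => 1 * f a b + 1 * (if a = u ∧ b = v then w (u, v) - f u v else 0), ⟨?_, ?_⟩,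
      w (u, v) - f u v, sub_pos.mpr h, ?_⟩
    · intro a b
      have := hf.1 a b
      dsimp only
      split_ifs <;> linarith
    · intro a b
      have := hf.2 a b
      dsimp only
      split_ifs with hab
      · obtain ⟨rfl, rfl⟩ := hab; linarith
      · linarith
    · intro x
      rw [divergence_combination, divergence_single]; ring
  · refine ⟨fun a b => 1 * f a b + (-1) * (if a = v ∧ b = u then f v u else 0), ⟨?_, ?_⟩,
      f v u, h, ?_⟩
    · intro a b
      have := hf.1 a b
      dsimp only
      split_ifs with hab
      · obtain ⟨rfl, rfl⟩ := hab; linarith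
      · linarith
    · intro a b
      have := hf.2 a b
      dsimp only
      split_ifs <;> linarith
    · intro x
      rw [divergence_combination, divergence_single]; ring

/-- If `v` can be reached in the residual graph, then some additional flow can be sent from `s` to
`v`: convex combinations of the flows that push along the single edges of a path. -/
lemma exists_augmented {w : V × V → ℕ} {f : V → V → ℝ} (hf : RespectsCapacity w f) {s v : V}
    (h : Relation.ReflTransGen (Residual w f) s v) :
    ∃ g, RespectsCapacity w g ∧ ∃ ε : ℝ, 0 < ε ∧ ∀ x,
      divergence g x = divergence f x + ε * ((if x = s then 1 else 0) - if x = v then 1 else 0) := by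
  induction h with
  | refl => exact ⟨f, hf, 1, one_pos, fun x => by ring⟩
  | tail _ hr ih =>
    obtain ⟨g, hg, ε, hε, hgd⟩ := ih
    obtain ⟨h, hh, η, hη, hhd⟩ := exists_push hf hr
    have hs : 0 < ε + η := by positivity
    have h1 : η / (ε + η) + ε / (ε + η) = 1 := by field_simp; ring
    have ha : 0 ≤ η / (ε + η) := by positivity
    have hb : 0 ≤ ε / (ε + η) := by positivity
    refine ⟨fun a b => η / (ε + η) * g a b + ε / (ε + η) * h a b, ⟨?_, ?_⟩,
      ε * η / (ε + η), by positivity, ?_⟩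
    · intro a b
      exact add_nonneg (mul_nonneg ha (hg.1 a b)) (mul_nonneg hb (hh.1 a b))
    · intro a b
      have e1 := mul_le_mul_of_nonneg_left (hg.2 a b) ha
      have e2 := mul_le_mul_of_nonneg_left (hh.2 a b) hb
      have e3 : η / (ε + η) * (w (a, b) : ℝ) + ε / (ε + η) * (w (a, b) : ℝ) = w (a, b) := by
        rw [← add_mul, h1, one_mul]
      linarith
    · intro x
      rw [divergence_combination, hgd, hhd]
      field_simp
      ring

/-- A maximum flow has the value of a minimum cut, namely of the set of vertices that can be reached
in the residual graph. -/
theorem IsMaxFlowDirected.isMinCut {s t : V} (hst : s ≠ t) {w : V × V → ℕ} {x : ℝ}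
    (h : IsMaxFlowDirected s t w x) : IsMinCutDirected s t w x := by
  classical
  obtain ⟨⟨f, hf, hw, rfl⟩, hmax⟩ := h
  have hcap : RespectsCapacity w f := ⟨hf.1, hw⟩
  constructor
  · by_cases ht : Relation.ReflTransGen (Residual w f) s t
    · exfalso
      obtain ⟨g, hg, ε, hε, hgd⟩ := exists_augmented hcap ht
      have hcons : IsConserved s t g := by
        refine ⟨hg.1, fun v hvs hvt => ?_⟩
        have h1 := hgd v
        have h2 := hf.2 v hvs hvt
        simp only [divergence, hvs, hvt, if_false] at h1
        linarith
      have hle : flowValue s g ≤ flowValue s f := hmax ⟨g, hcons, hg.2, rfl⟩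
      have h1 := hgd s
      simp only [if_true, hst, if_false] at h1
      change divergence g s ≤ divergence f s at hle
      linarith
    · refine ⟨univ.filter fun v => Relation.ReflTransGen (Residual w f) s v, ?_, ?_, ?_⟩
      · simpa using Relation.ReflTransGen.refl
      · simpa using ht
      · rw [flowValue_eq_cut hf (univ.filter fun v => Relation.ReflTransGen (Residual w f) s v)
          (by simpa using Relation.ReflTransGen.refl) (by simpa using ht), ← Finset.sum_sub_distrib]
        refine Finset.sum_congr rfl fun u hu => ?_
        rw [← Finset.sum_sub_distrib]
        refine Finset.sum_congr rfl fun v hv => ?_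
        simp only [Finset.mem_compl, Finset.mem_filter, Finset.mem_univ, true_and] at hu hv
        have hr : ¬ Residual w f u v := fun hr => hv (hu.tail hr)
        unfold Residual at hr
        push Not at hr
        have := hw u v
        have := hf.1 v u
        linarith
  · rintro y ⟨A, hs, ht, rfl⟩
    exact flowValue_le_cut hf hw A hs ht

lemma isMinCutUndirected_iff (s t : V) (w : Sym2 V → ℕ) (x : ℝ) :
    IsMinCutUndirected s t w x ↔ IsMinCutDirected s t (fun e => w s(e.1, e.2)) x := by
  unfold IsMinCutUndirected IsMinCutDirected
  exact Iff.rfl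

theorem IsMaxFlowUndirected.isMinCut {s t : V} (hst : s ≠ t) {w : Sym2 V → ℕ} {x : ℝ}
    (h : IsMaxFlowUndirected s t w x) : IsMinCutUndirected s t w x := by
  rw [isMinCutUndirected_iff]
  exact IsMaxFlowDirected.isMinCut hst (IsMaxFlowUndirected.isMaxFlowDirected h)

end Flow

/-! ### Reductions between the four problems -/

section Reductions

lemma computes_mono {ε Ω : Type} [MeasurableSpace Ω] {p S : ℕ} {P : Measure Ω}
    {A : Ω → StreamAlg (ε × ℕ) p S} {δ : ℝ} {Admissible : (ε → ℕ) → Prop}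
    {IsAnswer IsAnswer' : (ε → ℕ) → ℝ → Prop} (h : ∀ w x, IsAnswer w x → IsAnswer' w x)
    (hA : Computes P A δ Admissible IsAnswer) : Computes P A δ Admissible IsAnswer' :=
  fun w hw σ hσ => ⟨(hA w hw σ hσ).1, (hA w hw σ hσ).2.trans (measure_mono fun _ hω => h _ _ hω)⟩

variable {n p S : ℕ}

/-- The two directed versions of an undirected edge. -/
def orientations (q : Sym2 (Fin n) × ℕ) : List ((Fin n × Fin n) × ℕ) :=
  [((q.1.inf, q.1.sup), q.2), ((q.1.sup, q.1.inf), q.2)]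

/-- An algorithm for directed graphs, run on an undirected graph: each edge that is read is replaced
by two opposite edges. -/
def onUndirected (A : StreamAlg ((Fin n × Fin n) × ℕ) p S) : StreamAlg (Sym2 (Fin n) × ℕ) p S where
  init := A.init
  step i j q μ := readFrom A i (2 * j) (orientations q) μ
  out := A.out

lemma readFrom_onUndirected (A : StreamAlg ((Fin n × Fin n) × ℕ) p S) (i : Fin p) (o : ℕ)
    (σ : List (Sym2 (Fin n) × ℕ)) (μ : Fin S → Bool) :
    readFrom (onUndirected A) i o σ μ = readFrom A i (2 * o) (σ.flatMap orientations) μ := by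
  induction σ generalizing o μ with
  | nil => rfl
  | cons q σ ih =>
    have h1 : readFrom (onUndirected A) i o (q :: σ) μ
        = readFrom (onUndirected A) i (o + 1) σ (readFrom A i (2 * o) (orientations q) μ) := rfl
    rw [h1, ih, List.flatMap_cons, readFrom_append]
    rfl

lemma run_onUndirected (A : StreamAlg ((Fin n × Fin n) × ℕ) p S) (σ : List (Sym2 (Fin n) × ℕ)) :
    (onUndirected A).run σ = A.run (σ.flatMap orientations) := by
  have : ∀ i μ, (onUndirected A).runPass i σ μ = A.runPass i (σ.flatMap orientations) μ :=
    fun i μ => readFrom_onUndirected A i 0 σ μ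
  unfold StreamAlg.run StreamAlg.finalMemory
  simp only [this]
  rfl

lemma mk_inf_sup (e : Sym2 (Fin n)) : s(e.inf, e.sup) = e := by
  induction e with
  | _ a b =>
    simp only [Sym2.inf_mk, Sym2.sup_mk]
    rcases le_total a b with h | h
    · simp [h]
    · simp [h, Sym2.eq_swap]

lemma mem_orientations {q : Sym2 (Fin n) × ℕ} {u v : Fin n} {x : ℕ} :
    ((u, v), x) ∈ orientations q ↔ s(u, v) = q.1 ∧ x = q.2 := by
  obtain ⟨e, y⟩ := q
  simp only [orientations, List.mem_cons, Prod.mk.injEq, List.not_mem_nil, or_false]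
  conv_rhs => rw [← mk_inf_sup e, Sym2.eq_iff]
  tauto

lemma isEdgeStream_orientations {w : Sym2 (Fin n) → ℕ} (hw : ∀ v, w s(v, v) = 0)
    {σ : List (Sym2 (Fin n) × ℕ)} (hσ : IsEdgeStream w σ) :
    IsEdgeStream (fun e : Fin n × Fin n => w s(e.1, e.2)) (σ.flatMap orientations) := by
  constructor
  · rw [List.nodup_flatMap]
    constructor
    · rintro ⟨e, x⟩ hq
      have hx := (hσ.2 e x).mp hq
      have hne : e.inf ≠ e.sup := by
        intro h
        have h1 := mk_inf_sup e
        rw [h] at h1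
        have := hw e.sup
        rw [h1] at this
        omega
      simp [orientations, hne]
    · refine hσ.1.imp_of_mem ?_
      rintro q q' _ _ hne ⟨⟨u, v⟩, x⟩ h h'
      rw [mem_orientations] at h h'
      exact hne (Prod.ext (h.1.symm.trans h'.1) (h.2.symm.trans h'.2))
  · rintro ⟨u, v⟩ x
    rw [List.mem_flatMap]
    constructor
    · rintro ⟨⟨e, y⟩, hq, h⟩
      rw [mem_orientations] at h
      obtain ⟨rfl, rfl⟩ := h
      exact (hσ.2 _ _).mp hq
    · intro h
      exact ⟨(s(u, v), x), (hσ.2 _ _).mpr h, mem_orientations.mpr ⟨rfl, rfl⟩⟩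

lemma computes_onUndirected {Ω : Type} [MeasurableSpace Ω] {P : Measure Ω}
    {A : Ω → StreamAlg ((Fin n × Fin n) × ℕ) p S} {δ : ℝ} {W : ℕ} {s t : Fin n}
    (hA : Computes P A δ (AdmissibleDirected W) (IsMinCutDirected s t)) :
    Computes P (fun ω => onUndirected (A ω)) δ (AdmissibleUndirected W)
      (IsMinCutUndirected s t) := by
  intro w hw σ hσ
  have := hA (fun e => w s(e.1, e.2)) ⟨hw.1, fun e => hw.2 _⟩ _
    (isEdgeStream_orientations hw.1 hσ)
  simp only [run_onUndirected, isMinCutUndirected_iff]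
  exact this

end Reductions

/-! ### The space bound -/

section SpaceBound

/-- Averaging over the inputs: if each of the events has probability at least `δ`, then some outcome
lies in a fraction `δ` of the events. -/
lemma le_of_forall_sum_indicator_le {Ω ι : Type*} [MeasurableSpace Ω] {P : Measure Ω}
    [IsProbabilityMeasure P] [Fintype ι] [Nonempty ι] {E : ι → Set Ω}
    (hE : ∀ i, MeasurableSet (E i)) {δ β : ℝ} (hδ : ∀ i, ENNReal.ofReal δ ≤ P (E i))
    (hβ : ∀ ω, 𝔼 i, (E i).indicator (fun _ => (1 : ℝ)) ω ≤ β) : δ ≤ β := by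
  have h1 : ∀ i, δ ≤ ∫ ω, (E i).indicator (fun _ => (1 : ℝ)) ω ∂P := by
    intro i
    rw [integral_indicator_const _ (hE i), smul_eq_mul, mul_one]
    exact (ENNReal.ofReal_le_iff_le_toReal (measure_ne_top _ _)).mp (hδ i)
  have h2 : ∀ i, Integrable (fun ω => (E i).indicator (fun _ => (1 : ℝ)) ω) P :=
    fun i => (integrable_const 1).indicator (hE i)
  have hn : (0 : ℝ) < Fintype.card ι := by exact_mod_cast Fintype.card_pos
  have h3 : ∫ ω, ∑ i, (E i).indicator (fun _ => (1 : ℝ)) ω ∂P ≤ ∫ _ω, Fintype.card ι * β ∂P := by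
    refine integral_mono (integrable_finsetSum _ fun i _ => h2 i) (integrable_const _) fun ω => ?_
    have := hβ ω
    rw [Fintype.expect_eq_sum_div_card, div_le_iff₀ hn] at this
    simp only
    linarith
  rw [integral_finsetSum _ fun i _ => h2 i, integral_const] at h3
  have h4 : ∑ _i : ι, δ ≤ ∑ i, ∫ ω, (E i).indicator (fun _ => (1 : ℝ)) ω ∂P :=
    Finset.sum_le_sum fun i _ => h1 i
  simp only [Finset.sum_const, Finset.card_univ, nsmul_eq_mul, probReal_univ, one_smul] at h3 h4
  exact le_of_mul_le_mul_left (h4.trans h3) hn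

/-- The version of the averaging principle for algorithms with a unique correct answer. -/
lemma Computes.le_of_forall {ε Ω ι : Type} [MeasurableSpace Ω] {p S : ℕ} {P : Measure Ω}
    [IsProbabilityMeasure P] [Fintype ι] [Nonempty ι] {A : Ω → StreamAlg (ε × ℕ) p S} {δ β : ℝ}
    {Admissible : (ε → ℕ) → Prop} {IsAnswer : (ε → ℕ) → ℝ → Prop}
    (hA : Computes P A δ Admissible IsAnswer) (w : ι → ε → ℕ) (σ : ι → List (ε × ℕ)) (val : ι → ℝ)
    (hw : ∀ i, Admissible (w i)) (hσ : ∀ i, IsEdgeStream (w i) (σ i))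
    (hval : ∀ i x, IsAnswer (w i) x → x = val i)
    (hβ : ∀ ω, 𝔼 i, (if (A ω).run (σ i) = val i then 1 else 0) ≤ β) : δ ≤ β := by
  refine le_of_forall_sum_indicator_le (P := P) (E := fun i => {ω | (A ω).run (σ i) = val i})
    (fun i => ?_) (fun i => ?_) fun ω => ?_
  · exact (hA (w i) (hw i) (σ i) (hσ i)).1 (measurableSet_singleton _)
  · exact (hA (w i) (hw i) (σ i) (hσ i)).2.trans (measure_mono fun ω hω => hval i _ hω)
  · refine le_trans (le_of_eq ?_) (hβ ω)
    refine expect_congr rfl fun i _ => ?_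
    simp only [Set.indicator_apply, Set.mem_ofPred_eq]

lemma isMinCutUndirected_unique {V : Type} [Fintype V] [DecidableEq V] {s t : V} {w : Sym2 V → ℕ}
    {x y : ℝ} (hx : IsMinCutUndirected s t w x) (hy : IsMinCutUndirected s t w y) : x = y :=
  IsLeast.unique hx hy

/-- The number of steps after which layer `i` is about to act in pass `i`. -/
def roundEnd (k i : ℕ) : ℕ := 2 * k * i + 2 * (k - 1 - i)

variable {k : ℕ}

lemma playerAt_ne_zero_of_lt (hk : 0 < k) (t : ℕ) (ht : t < roundEnd k 0) :
    (playerAt k hk t).1.val ≠ 0 := by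
  unfold roundEnd at ht
  simp only [playerAt]
  rw [Nat.mod_eq_of_lt (by omega)]
  omega

lemma playerAt_ne_of_between (hk : 0 < k) (i : ℕ) (hi : i + 1 < k) :
    roundEnd k i ≤ roundEnd k (i + 1) ∧
      ∀ t, roundEnd k i ≤ t → t < roundEnd k (i + 1) → (playerAt k hk t).1.val ≠ i + 1 := by
  unfold roundEnd
  have e : 2 * k * (i + 1) = 2 * k * i + 2 * k := by ring
  refine ⟨by omega, fun t h1 h2 h3 => ?_⟩
  simp only [playerAt] at h3
  have h4 := Nat.div_add_mod t (2 * k)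
  have h5 := Nat.mod_lt t (show 0 < 2 * k by omega)
  rcases Nat.lt_or_ge i (t / (2 * k)) with h | h
  · have := Nat.mul_le_mul_left (2 * k) (Nat.succ_le_of_lt h)
    rw [Nat.succ_eq_add_one] at this
    omega
  · have := Nat.mul_le_mul_left (2 * k) h
    omega

lemma card_playerAt_le (hk : 0 < k) (i : Fin k) {p T : ℕ} (hT : T ≤ 2 * k * p) :
    ((range T).filter fun t => (playerAt k hk t).1 = i).card ≤ 2 * p := by
  have : ((range p) ×ˢ (range 2)).card = 2 * p := by simp [mul_comm]
  rw [← this]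
  refine Finset.card_le_card_of_injOn (fun t => (t / (2 * k), t % 2)) ?_ ?_
  · intro t ht
    simp only [Finset.coe_filter, Finset.mem_range, Set.mem_ofPred_eq] at ht
    simp only [Finset.coe_product, Set.mem_prod, Finset.coe_range, Set.mem_Iio]
    exact ⟨Nat.div_lt_of_lt_mul (lt_of_lt_of_le ht.1 hT), by omega⟩
  · intro t ht t' ht' h
    simp only [Finset.coe_filter, Set.mem_ofPred_eq] at ht ht'
    have h1 := congrArg Fin.val ht.2
    have h2 := congrArg Fin.val ht'.2
    simp only [playerAt] at h1 h2
    obtain ⟨h3, h4⟩ := Prod.ext_iff.mp h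
    simp only at h3 h4
    have e1 := Nat.div_add_mod t (2 * k)
    have e2 := Nat.div_add_mod t' (2 * k)
    have e3 := Nat.mod_mul_right_mod t 2 k
    have e4 := Nat.mod_mul_right_mod t' 2 k
    have e5 := Nat.mod_lt t (show 0 < 2 * k by omega)
    have e6 := Nat.mod_lt t' (show 0 < 2 * k by omega)
    rw [h3] at e1
    omega

/-- If the minimum cut is computed with probability at least `δ`, then the memory cannot be small,
because the end of the hidden path can be read off from the answer. -/
lemma Computes.le_of_embedding {n m p S : ℕ} {s t : Fin n} {Ω : Type} [MeasurableSpace Ω]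
    {P : Measure Ω} [IsProbabilityMeasure P] {A : Ω → StreamAlg (Sym2 (Fin n) × ℕ) p S} {δ : ℝ}
    {W : ℕ} (hp : 1 ≤ p) (hm : 2 ≤ m) (hW : hugeWeight (p + 1) m ≤ W)
    (ι : Vtx (p + 1) m → Fin n) (hι : Injective ι) (hs : ι .src = s) (ht : ι .snk = t)
    (hA : Computes P A δ (AdmissibleUndirected W) (IsMinCutUndirected s t)) {θ : ℝ} (hθ : 0 < θ) :
    δ ≤ 1 / m + p * (θ + 64 * (2 * p * S) / (θ * m ^ 2)) := by
  subst hs ht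
  have hk : 0 < p + 1 := Nat.succ_pos p
  have : Nonempty (Fin m) := ⟨⟨0, by omega⟩⟩
  let x₀ : Fin m := ⟨0, by omega⟩
  let P₀ : Fin (p + 1) × Bool := (0, true)
  let I : (Fin (p + 1 + 1) → Fin m) × Protocol.Seeds (p + 1) (Fin m) →
      Fin (p + 1) × Bool → Fin m × Fin m → Bool := fun q => Protocol.inputs x₀ (p + 1) q.1 q.2
  refine Computes.le_of_forall hA (fun q => netWeight ι x₀ (I q))
    (fun q => netStream hk ι x₀ P₀ (I q))
    (fun q => ((cutValue (p + 1) m (q.1 (Fin.last (p + 1))) : ℤ) : ℝ))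
    (fun q => netWeight_admissible hι x₀ (I q) hW)
    (fun q => isEdgeStream_netStream hk hm hι x₀ P₀ (I q)) (fun q x hx => ?_) fun ω => ?_
  · have h := isMinCut_netWeight hk hm (ζ := pathVertex x₀ q.1) (x₀ := x₀) rfl
      (isPath_inputs x₀ q.1 q.2) hι
    exact isMinCutUndirected_unique hx h
  · let π := streamProtocol hk ι x₀ P₀ hp (A ω)
    let g : (Fin S → Bool) → Fin m → ℝ := fun μ y =>
      if (A ω).out μ = ((cutValue (p + 1) m y : ℤ) : ℝ) then 1 else 0
    have hg0 : ∀ μ y, 0 ≤ g μ y := fun μ y => by simp only [g]; split_ifs <;> norm_num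
    have hg1 : ∀ μ, ∑ y, g μ y ≤ 1 := by
      intro μ
      by_cases h : ∃ y, (A ω).out μ = ((cutValue (p + 1) m y : ℤ) : ℝ)
      · obtain ⟨y, hy⟩ := h
        rw [Finset.sum_eq_single y]
        · exact (if_pos hy).le
        · intro y' _ hne
          refine if_neg fun h => hne ?_
          rw [hy] at h
          exact (cutValue_injective _ _ (Int.cast_injective h)).symm
        · simp
      · push Not at h
        simp [g, h]
    have key := π.avg_guess_le x₀ (roundEnd (p + 1)) (playerAt_ne_zero_of_lt hk)
      (playerAt_ne_of_between hk) (N := 2 * p)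
      (fun i j hj => card_playerAt_le hk i (by
        have h1 : j + 1 ≤ p := by have := i.2; omega
        have h2 := Nat.mul_le_mul_left (2 * (p + 1)) h1
        unfold roundEnd
        rw [mul_add] at h2
        omega)) hθ rfl g hg0 hg1
    have hend : roundEnd (p + 1) p = 2 * (p + 1) * p := by unfold roundEnd; omega
    rw [hend] at key
    have hlog : Real.log (Fintype.card (Fin S → Bool)) ≤ S := by
      have : (Fintype.card (Fin S → Bool) : ℝ) = 2 ^ S := by simp
      rw [this, Real.log_pow]
      have := Real.log_two_lt_d9
      have : (0 : ℝ) ≤ S := Nat.cast_nonneg S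
      nlinarith
    have hm0 : (0 : ℝ) < m := by exact_mod_cast (by omega : 0 < m)
    calc 𝔼 q : (Fin (p + 1 + 1) → Fin m) × Protocol.Seeds (p + 1) (Fin m),
          (if (A ω).run (netStream hk ι x₀ P₀ (I q)) =
            ((cutValue (p + 1) m (q.1 (Fin.last (p + 1))) : ℤ) : ℝ) then (1 : ℝ) else 0)
        = π.avg x₀ (p + 1) fun z γ => g (γ (2 * (p + 1) * p)) (z (Fin.last (p + 1))) := by
          unfold Protocol.avg
          rw [← univ_product_univ, expect_product]
          refine expect_congr rfl fun z _ => expect_congr rfl fun v _ => ?_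
          simp only [g, π, I, states_streamProtocol]
          rfl
      _ ≤ _ := key
      _ ≤ 1 / m + p * (θ + 64 * (2 * p * S) / (θ * m ^ 2)) := by
          simp only [Fintype.card_prod, Fintype.card_fin]
          push_cast
          rw [sq]
          gcongr

/-- There is room for the network among `n` vertices. -/
lemma exists_embedding {k m n : ℕ} (h : 5 * m * (k + 1) + 2 ≤ n) {s t : Fin n} (hst : s ≠ t) :
    ∃ ι : Vtx k m → Fin n, Injective ι ∧ ι .src = s ∧ ι .snk = t := by
  have hcard : Fintype.card (Vtx k m) ≤ Fintype.card (Fin n) := by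
    simp only [Vtx, Fintype.card_sum, Fintype.card_prod, Fintype.card_fin, Fintype.card_bool]
    nlinarith
  obtain ⟨ι⟩ := Function.Embedding.nonempty_of_card_le hcard
  set e₁ := Equiv.swap (ι .src) s
  set e₂ := Equiv.swap (e₁ (ι .snk)) t
  have hne : e₁ (ι .snk) ≠ s := by
    intro h
    have h' : e₁ (ι .snk) = e₁ (ι .src) := by rw [h, Equiv.swap_apply_left]
    have := ι.injective (e₁.injective h')
    simp [Vtx.src, Vtx.snk] at this
  refine ⟨fun v => e₂ (e₁ (ι v)), e₂.injective.comp (e₁.injective.comp ι.injective), ?_, ?_⟩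
  · change e₂ (e₁ (ι .src)) = s
    rw [Equiv.swap_apply_left]
    exact Equiv.swap_apply_of_ne_of_ne hne.symm hst
  · exact Equiv.swap_apply_left _ _

/-- All weights are at most `n ^ (7 * p)`: the ratio of consecutive layers is at most `n ^ 2`, there
are `p + 1` layers, and the remaining factors are at most `n ^ 3`. -/
lemma hugeWeight_le {p m n : ℕ} (hp : 1 ≤ p) (hm : 2 ≤ m) (h : 5 * m * (p + 1 + 1) + 2 ≤ n) :
    hugeWeight (p + 1) m ≤ n ^ (7 * p) := by
  set R := ratio m with hR
  set k := p + 1 with hk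
  have hRn : R ≤ n ^ 2 := by
    have h1 : 5 * m ≤ n := by nlinarith
    have h2 : (5 * m) ^ 2 ≤ n ^ 2 := Nat.pow_le_pow_left h1 2
    have : R = 8 * m ^ 2 + 1 := rfl
    nlinarith
  have hfeed : ∀ (i : Fin k) (y : Fin m), feedWeight k m i y ≤ R ^ k * (8 * m) := by
    intro i y
    have h1 := Nat.mul_le_mul_right (4 * m - 5) (scale_le (k := k) (m := m) i)
    have h2 := Nat.mul_le_mul_right (4 * m + 2) (scale_le (k := k) (m := m) (i + 1))
    have h3 : R ^ k * (4 * m - 5) + R ^ k * (4 * m + 2) ≤ R ^ k * (8 * m) := by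
      rw [← mul_add]; exact Nat.mul_le_mul_left _ (by omega)
    rw [← hR] at h1 h2
    unfold feedWeight
    omega
  have hsum : ∑ i : Fin k, ∑ y : Fin m, feedWeight k m i y ≤ R ^ k * (8 * k * m ^ 2) := by
    calc ∑ i : Fin k, ∑ y : Fin m, feedWeight k m i y ≤ ∑ _i : Fin k, ∑ _y : Fin m, R ^ k * (8 * m) :=
          Finset.sum_le_sum fun i _ => Finset.sum_le_sum fun y _ => hfeed i y
      _ = R ^ k * (8 * k * m ^ 2) := by simp; ring
  have h0 := Nat.mul_le_mul_right (4 * m + 2) (scale_le (k := k) (m := m) 0)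
  have hR1 : 1 ≤ R ^ k := Nat.one_le_pow _ _ (Nat.succ_pos _)
  have h1 : hugeWeight k m ≤ R ^ k * (5 * m + 2 + 8 * k * m ^ 2) := by
    unfold hugeWeight baseCost
    have : m ≤ R ^ k * m := Nat.le_mul_of_pos_left _ hR1
    nlinarith
  have h2 : 5 * m + 2 + 8 * k * m ^ 2 ≤ n ^ 3 := by
    have e1 : 5 * m + 2 ≤ n := by nlinarith
    have e2 : (5 * m * (k + 1)) ^ 2 ≤ n ^ 2 := Nat.pow_le_pow_left (by omega) 2
    have e3 : 8 * k * m ^ 2 ≤ n ^ 2 := by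
      refine le_trans ?_ e2
      have : (5 * m * (k + 1)) ^ 2 = 25 * (k + 1) ^ 2 * m ^ 2 := by ring
      rw [this]
      exact Nat.mul_le_mul_right _ (by nlinarith)
    have e4 : 2 ≤ n := by omega
    nlinarith [Nat.mul_le_mul_left (n ^ 2) e4]
  have hn : 1 ≤ n := by omega
  calc hugeWeight k m ≤ R ^ k * (5 * m + 2 + 8 * k * m ^ 2) := h1
    _ ≤ (n ^ 2) ^ k * n ^ 3 := Nat.mul_le_mul (Nat.pow_le_pow_left hRn k) h2
    _ = n ^ (2 * k + 3) := by rw [← pow_mul, ← pow_add]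
    _ ≤ n ^ (7 * p) := Nat.pow_le_pow_right hn (by omega)

/-- Without memory, the weight of a single edge cannot be found. -/
lemma Computes.one_le_space {n p S : ℕ} {s t : Fin n} (hst : s ≠ t) {Ω : Type} [MeasurableSpace Ω]
    {P : Measure Ω} [IsProbabilityMeasure P] {A : Ω → StreamAlg (Sym2 (Fin n) × ℕ) p S} {δ : ℝ}
    {W : ℕ} (hW : n ≤ W) (hn : 1 < δ * n)
    (hA : Computes P A δ (AdmissibleUndirected W) (IsMinCutUndirected s t)) : 1 ≤ S := by
  by_contra hS
  have hS : S = 0 := by omega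
  subst hS
  have hn0 : 0 < n := s.pos
  have : Nonempty (Fin n) := ⟨s⟩
  let w : Fin n → Sym2 (Fin n) → ℕ := fun j e => if e = s(s, t) then j.val + 1 else 0
  have hle : δ ≤ 1 / n := by
    refine Computes.le_of_forall hA w (fun j => [(s(s, t), j.val + 1)])
      (fun j => ((j.val + 1 : ℕ) : ℝ)) (fun j => ⟨fun v => ?_, fun e => ?_⟩)
      (fun j => ⟨List.nodup_singleton _, fun e x => ?_⟩) (fun j x hx => ?_) fun ω => ?_
    · refine if_neg fun h => hst ?_
      rw [Sym2.eq_iff] at h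
      rcases h with ⟨h1, h2⟩ | ⟨h1, h2⟩
      · exact h1.symm.trans h2
      · exact h2.symm.trans h1
    · simp only [w]
      have := j.2
      split_ifs <;> omega
    · simp only [List.mem_singleton, Prod.mk.injEq, w]
      constructor
      · rintro ⟨rfl, rfl⟩; simp
      · rintro ⟨h, hx⟩
        split_ifs at h with he
        · exact ⟨he, h.symm⟩
        · omega
    · have hcut : ∀ B : Finset (Fin n), s ∈ B → t ∉ B →
          ∑ u ∈ B, ∑ v ∈ Bᶜ, (w j s(u, v) : ℝ) = ((j.val + 1 : ℕ) : ℝ) := by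
        intro B hs ht
        have h1 := sum_cut_edge B s t (j.val + 1)
        simp only [hs, ht, decide_true, decide_false, ne_eq, Bool.true_eq_false, not_false_eq_true,
          if_true] at h1
        rw [← h1]
        push_cast
        refine Finset.sum_congr rfl fun u _ => Finset.sum_congr rfl fun v _ => ?_
        simp only [w, eq_comm (a := s(u, v))]
        push_cast
        rfl
      refine isMinCutUndirected_unique hx ⟨⟨{s}, by simp, by simpa using hst.symm, ?_⟩, ?_⟩
      · exact (hcut _ (by simp) (by simpa using hst.symm)).symm
      · rintro y ⟨B, hs, ht, rfl⟩
        exact (hcut B hs ht).ge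
    · rw [Fintype.expect_eq_sum_div_card, Fintype.card_fin]
      refine div_le_div_of_nonneg_right ?_ (Nat.cast_nonneg n)
      have hrun : ∀ σ, (A ω).run σ = (A ω).out fun i => i.elim0 := fun σ =>
        congrArg (A ω).out (funext fun i => i.elim0)
      simp only [hrun]
      by_cases h : ∃ j : Fin n, ((A ω).out fun i => i.elim0) = ((j.val + 1 : ℕ) : ℝ)
      · obtain ⟨j, hj⟩ := h
        rw [Finset.sum_eq_single j]
        · exact (if_pos hj).le
        · intro j' _ hne
          refine if_neg fun h => hne ?_
          rw [hj] at h
          have := Nat.cast_injective h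
          exact Fin.ext (by omega)
        · simp
      · push Not at h
        simp only [h, if_false, Finset.sum_const_zero, zero_le_one]
  rw [le_div_iff₀ (by exact_mod_cast hn0)] at hle
  linarith

/-- The space bound for minimum cuts of undirected graphs. -/
theorem exists_undirected_bound (δ : ℝ) (hδ : 0 < δ) : ∃ c : ℝ, 0 < c ∧ ∃ n₀ : ℕ,
    ∀ n : ℕ, n₀ ≤ n → ∀ p : ℕ, 1 ≤ p → ∀ (S : ℕ) (s t : Fin n), s ≠ t →
      ∀ (Ω : Type) [MeasurableSpace Ω] (P : Measure Ω) [IsProbabilityMeasure P]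
        (A : Ω → StreamAlg (Sym2 (Fin n) × ℕ) p S),
        Computes P A δ (AdmissibleUndirected (n ^ (7 * p))) (IsMinCutUndirected s t) →
          c * ((n : ℝ) ^ 2 / (p : ℝ) ^ 5) ≤ (S : ℝ) := by
  -- `M` is large enough to make blind guessing succeed with probability at most `δ / 4`
  obtain ⟨M, hM2, hM4⟩ : ∃ M : ℕ, 2 ≤ M ∧ 4 / δ ≤ M := by
    obtain ⟨M, hM⟩ := exists_nat_ge (4 / δ)
    exact ⟨max M 2, le_max_right _ _, hM.trans (by exact_mod_cast le_max_left _ _)⟩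
  have hMpos : (0 : ℝ) < M := by exact_mod_cast (by omega : 0 < M)
  -- `1000000 ≥ 1024 * 31 ^ 2` and `289 = 17 ^ 2` come from `n ≤ 31 * p * m` in the case of many
  -- vertices per level, and `n ≤ 17 * p * M` in the other case
  refine ⟨min (δ ^ 2 / 1000000) (1 / (289 * M ^ 2)), by positivity, M, ?_⟩
  intro n hn p hp S s t hst Ω _ P _ A hA
  have hp1 : (1 : ℝ) ≤ p := by exact_mod_cast hp
  have hp0 : (0 : ℝ) < p := by linarith
  have hn0 : (0 : ℝ) ≤ n := Nat.cast_nonneg n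
  have hq : (0 : ℝ) ≤ (n : ℝ) ^ 2 / (p : ℝ) ^ 5 := by positivity
  set m := (n - 2) / (5 * (p + 2)) with hm
  have hd := Nat.div_add_mod (n - 2) (5 * (p + 2))
  have hr := Nat.mod_lt (n - 2) (show 0 < 5 * (p + 2) by omega)
  rw [← hm] at hd
  by_cases hmM : M ≤ m
  · have hm2 : 2 ≤ m := hM2.trans hmM
    have hroom : 5 * m * (p + 1 + 1) + 2 ≤ n := by
      have : 5 * (p + 2) * m = 5 * m * (p + 1 + 1) := by ring
      have : 1 ≤ 5 * (p + 2) * m := Nat.mul_pos (by omega) (by omega)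
      omega
    obtain ⟨ι, hι, hs, ht⟩ := exists_embedding hroom hst
    have hm0 : (0 : ℝ) < m := by exact_mod_cast (by omega : 0 < m)
    have key := Computes.le_of_embedding hp hm2 (hugeWeight_le hp hm2 hroom) ι hι hs ht hA
      (θ := δ / (4 * p)) (by positivity)
    -- blind guessing and the summand `p * θ` account for at most `δ / 2`
    have hguess : 1 / (m : ℝ) ≤ δ / 4 := by
      have h1 : 4 / δ ≤ m := hM4.trans (by exact_mod_cast hmM)
      rw [div_le_iff₀ hδ] at h1
      rw [div_le_div_iff₀ hm0 (by norm_num)]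
      linarith
    have hnm : (n : ℝ) ≤ 31 * p * m := by
      have h1 : n ≤ 5 * (p + 2) * (m + 1) + 2 := by
        have : 5 * (p + 2) * (m + 1) = 5 * (p + 2) * m + 5 * (p + 2) := by ring
        omega
      have h2 : 5 * (p + 2) * (m + 1) ≤ 5 * (3 * p) * (m + 1) := by gcongr; omega
      have h3 : 5 * (3 * p) * (m + 1) + 2 ≤ 31 * p * m := by nlinarith
      exact_mod_cast h1.trans (by omega)
    have e : (p : ℝ) * (δ / (4 * p) + 64 * (2 * p * S) / (δ / (4 * p) * m ^ 2))
        = δ / 4 + 512 * p ^ 3 * S / (δ * m ^ 2) := by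
      field_simp; ring
    rw [e] at key
    have h5 : δ / 2 ≤ 512 * p ^ 3 * S / (δ * m ^ 2) := by linarith
    rw [div_le_div_iff₀ (by norm_num) (by positivity)] at h5
    refine (mul_le_mul_of_nonneg_right (min_le_left _ _) hq).trans ?_
    rw [div_mul_div_comm, div_le_iff₀ (by positivity)]
    have h6 : (n : ℝ) ^ 2 ≤ (31 * p * m) ^ 2 := pow_le_pow_left₀ hn0 hnm 2
    have h7 := mul_le_mul_of_nonneg_left h6 (sq_nonneg δ)
    have h8 := mul_le_mul_of_nonneg_left h5 (show (0 : ℝ) ≤ 961 * p ^ 2 by positivity)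
    have h9 : (0 : ℝ) ≤ S * p ^ 5 := by positivity
    nlinarith
  · push Not at hmM
    have hS : 1 ≤ S := by
      refine Computes.one_le_space hst (W := n ^ (7 * p)) (Nat.le_self_pow (by omega) n) ?_ hA
      rw [div_le_iff₀ hδ] at hM4
      have : (M : ℝ) ≤ n := by exact_mod_cast hn
      nlinarith
    have hS' : (1 : ℝ) ≤ S := by exact_mod_cast hS
    have hnM : (n : ℝ) ≤ 17 * p * M := by
      have h1 : n ≤ 5 * (p + 2) * (m + 1) + 2 := by
        have : 5 * (p + 2) * (m + 1) = 5 * (p + 2) * m + 5 * (p + 2) := by ring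
        omega
      have h2 : 5 * (p + 2) * (m + 1) ≤ 5 * (3 * p) * M := by gcongr <;> omega
      have h3 : 5 * (3 * p) * M + 2 ≤ 17 * p * M := by nlinarith
      exact_mod_cast h1.trans (by omega)
    refine le_trans ?_ hS'
    refine (mul_le_mul_of_nonneg_right (min_le_right _ _) hq).trans ?_
    rw [div_mul_div_comm, one_mul, div_le_one (by positivity)]
    calc (n : ℝ) ^ 2 ≤ (17 * p * M) ^ 2 := pow_le_pow_left₀ hn0 hnM 2
      _ = 289 * M ^ 2 * p ^ 2 := by ring
      _ ≤ 289 * M ^ 2 * p ^ 5 := by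
          have : (p : ℝ) ^ 2 ≤ p ^ 5 := pow_le_pow_right₀ hp1 (by norm_num)
          gcongr

end SpaceBound

end HiddenPath


theorem theorem6p1 :
    ∃ C : ℕ, ∀ δ : ℝ, 0 < δ → ∃ c : ℝ, 0 < c ∧ ∃ n₀ : ℕ,
      ∀ n : ℕ, n₀ ≤ n → ∀ p : ℕ, 1 ≤ p → ∀ (S : ℕ) (s t : Fin n), s ≠ t →
      ∀ (Ω : Type) [MeasurableSpace Ω] (P : Measure Ω) [IsProbabilityMeasure P],
        (∀ A : Ω → StreamAlg ((Fin n × Fin n) × ℕ) p S,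
          Computes P A δ (AdmissibleDirected (n ^ (C * p))) (IsMinCutDirected s t) →
            c * ((n : ℝ) ^ 2 / (p : ℝ) ^ 5) ≤ (S : ℝ)) ∧
        (∀ A : Ω → StreamAlg (Sym2 (Fin n) × ℕ) p S,
          Computes P A δ (AdmissibleUndirected (n ^ (C * p))) (IsMinCutUndirected s t) →
            c * ((n : ℝ) ^ 2 / (p : ℝ) ^ 5) ≤ (S : ℝ)) ∧
        (∀ A : Ω → StreamAlg ((Fin n × Fin n) × ℕ) p S,
          Computes P A δ (AdmissibleDirected (n ^ (C * p))) (IsMaxFlowDirected s t) →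
            c * ((n : ℝ) ^ 2 / (p : ℝ) ^ 5) ≤ (S : ℝ)) ∧
        (∀ A : Ω → StreamAlg (Sym2 (Fin n) × ℕ) p S,
          Computes P A δ (AdmissibleUndirected (n ^ (C * p))) (IsMaxFlowUndirected s t) →
            c * ((n : ℝ) ^ 2 / (p : ℝ) ^ 5) ≤ (S : ℝ)) := by
  refine ⟨7, fun δ hδ => ?_⟩
  obtain ⟨c, hc, n₀, h⟩ := HiddenPath.exists_undirected_bound δ hδ
  refine ⟨c, hc, n₀, fun n hn p hp S s t hst Ω _ P _ => ⟨fun A hA => ?_, fun A hA => ?_,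
    fun A hA => ?_, fun A hA => ?_⟩⟩
  · exact h n hn p hp S s t hst Ω P _ (HiddenPath.computes_onUndirected hA)
  · exact h n hn p hp S s t hst Ω P A hA
  · exact h n hn p hp S s t hst Ω P _ (HiddenPath.computes_onUndirected
      (HiddenPath.computes_mono (fun _ _ hx => HiddenPath.IsMaxFlowDirected.isMinCut hst hx) hA))
  · exact h n hn p hp S s t hst Ω P A
      (HiddenPath.computes_mono (fun _ _ hx => HiddenPath.IsMaxFlowUndirected.isMinCut hst hx) hA)
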